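/- Let $A$ be a finite-dimensional quantum system, let $r\ge 1$, and let $\rho_{[r]}=(\rho_1,\dots,\rho_r)$ be a tuple of states (positive semidefinite operators of unit trace) on $A$. Write $\mathcal P_r$ for the set of probability distributions on $\{1,\dots,r\}$, $\mathcal D_B$ for the set of states on a system $B$, and $\mathrm{aff}(\mathcal D_B)$ for the set of unit-trace Hermitian operators on $B$. For $\alpha\in(1,\infty)$, a nonzero Hermitian operator $\gamma$ and a positive semidefinite operator $\sigma$, the extended sandwiched Rényi divergence is $$\widetilde D_\alpha(\gamma\|\sigma)=\frac{1}{\alpha-1}\ln\left\|\sigma^{\frac{1-\alpha}{2\alpha}}\,\gamma\,\sigma^{\frac{1-\alpha}{2\alpha}}\right\|_\alpha^\alpha\quad\text{if }\mathrm{supp}(\gamma)\subseteq\mathrm{supp}(\sigma),$$ and $+\infty$ otherwise, where $\|\gamma\|_\alpha=(\mathrm{Tr}[(\gamma^\dagger\gamma)^{\alpha/2}])^{1/\alpha}$, $\mathrm{supp}$ denotes the range, and negative powers are taken on the support. The multivariate log-Euclidean Chernoff divergence is $$C^\flat(\rho_{[r]})=\sup_{s\in\mathcal P_r}\ \lim_{\varepsilon\searrow0}\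 -\ln\mathrm{Tr}\left[\exp\left(\sum_{x=1}^r s_x\ln(\rho_x+\varepsilon I)\right)\right],$$ where the limit exists in $[-\infty,+\infty]$ for every $s\in\mathcal P_r$. Then (with $0\cdot\infty=0$) $$\inf_{\alpha\in(1,\infty)}\ \limsup_{n\to\infty}\ \sup_{s\in\mathcal P_r}\ \inf_{\tau_n\in\mathrm{aff}(\mathcal D_{A^n})}\ \frac1n\sum_{x=1}^r s_x\,\widetilde D_\alpha\left(\tau_n\middle\|\rho_x^{\otimes n}\right)=C^\flat(\rho_{[r]}).$$ Hence neither the extension to Hermitian first arguments nor the regularization improves the bound: the left-hand side keeps the same value $C^\flat(\rho_{[r]})$ if $\mathrm{aff}(\mathcal D_{A^n})$ is replaced by $\mathcal D_{A^n}$, and likewise $$\inf_{\alpha\in(1,\infty)}\ \sup_{s\in\mathcal P_r}\ \inf_{\tau\in\mathrm{aff}(\mathcal D_A)}\ \sum_{x=1}^r s_x\,\widetilde D_\alpha(\tau\|\rho_x)=\inf_{\alpha\in(1,\infty)}\ \sup_{s\in\mathcal P_r}\ \inf_{\tau\in\mathcal D_A}\ \sum_{x=1}^r s_x\,\widetilde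 D_\alpha(\tau\|\rho_x)=C^\flat(\rho_{[r]}).$$ -/

import Mathlib

open scoped Topology

noncomputable section

namespace StateExclusion

open scoped ComplexOrder in
/-- Quantum states: positive semidefinite operators of unit trace. -/
def states (A : Type*) [Fintype A] : Set (Matrix A A ℂ) :=
  {ρ | ρ.PosSemidef ∧ ρ.trace = 1}

/-- `aff(D_A)`: Hermitian operators of unit trace. -/
def affStates (A : Type*) [Fintype A] : Set (Matrix A A ℂ) :=
  {τ | τ.IsHermitian ∧ τ.trace = 1}

/-- The `n`-fold tensor power of an operator on `ℂ^A`, acting on `(ℂ^A)^{⊗ n} = ℂ^(Fin n → A)`. -/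
def tensorPow {A : Type*} (n : ℕ) (ρ : Matrix A A ℂ) :
    Matrix (Fin n → A) (Fin n → A) ℂ :=
  Matrix.of fun i j => ∏ k, ρ (i k) (j k)

/-- The support (range) of an operator. -/
def supp {A : Type*} [Fintype A] (γ : Matrix A A ℂ) : Submodule ℂ (A → ℂ) :=
  LinearMap.range γ.mulVecLin

/-- The Schatten norm `‖γ‖_α = (Tr[(γ† γ)^(α/2)])^(1/α)`. -/
def schattenNorm {A : Type*} [Fintype A] [DecidableEq A] (α : ℝ) (γ : Matrix A A ℂ) : ℝ :=
  ((cfc (fun t : ℝ => t ^ (α / 2)) (γ.conjTranspose * γ)).trace.re) ^ (1 / α)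

/-- The power `σ^p`, `p ≠ 0`, of a positive semidefinite operator, taken on its support:
`(0 : ℝ) ^ p = 0` for every `p ≠ 0`, also for negative `p`. -/
def suppPow {A : Type*} [Fintype A] [DecidableEq A] (σ : Matrix A A ℂ) (p : ℝ) :
    Matrix A A ℂ :=
  cfc (fun t : ℝ => t ^ p) σ

open Classical in
/-- The extended sandwiched Rényi divergence of order `α > 1` of a nonzero Hermitian `γ`
relative to a positive semidefinite `σ`. -/
def sandwiched {A : Type*} [Fintype A] [DecidableEq A] (α : ℝ) (γ σ : Matrix A A ℂ) : EReal :=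
  if supp γ ≤ supp σ then
    ((1 / (α - 1) * Real.log
      (schattenNorm α (suppPow σ ((1 - α) / (2 * α)) * γ * suppPow σ ((1 - α) / (2 * α))) ^ α) :
        ℝ) : EReal)
  else ⊤

/-- `-ln Tr[exp(∑ₓ sₓ ln(ρₓ + ε I))]`. -/
def logEuclidean {A : Type*} [Fintype A] [DecidableEq A] {r : ℕ}
    (s : Fin r → ℝ) (ρ : Fin r → Matrix A A ℂ) (ε : ℝ) : ℝ :=
  -Real.log
    ((cfc Real.exp (∑ x, s x • cfc Real.log (ρ x + ε • (1 : Matrix A A ℂ)))).trace.re)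

/-- The multivariate log-Euclidean Chernoff divergence
`sup_s lim_{ε ↘ 0} -ln Tr[exp(∑ₓ sₓ ln(ρₓ + ε I))]`, the limit being taken in `[-∞, +∞]`. -/
def chernoffFlat {A : Type*} [Fintype A] [DecidableEq A] {r : ℕ}
    (ρ : Fin r → Matrix A A ℂ) : EReal :=
  ⨆ s ∈ stdSimplex ℝ (Fin r),
    Filter.limUnder (𝓝[>] (0 : ℝ)) fun ε => ((logEuclidean s ρ ε : ℝ) : EReal)

end StateExclusion

end

/-!
The sandwiched divergences are bounded below by Umegaki relative entropies, for states even with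
equality in the limit `α ↘ 1`, and weighted sums of relative entropies obey the Gibbs variational
principle: `∑ₓ sₓ D(τ‖ρₓ) ≥ -ln Tr exp(∑ₓ sₓ ln ρₓ)`, with equality for the Gibbs state of
`∑ₓ sₓ ln ρₓ`. All operators are handled in eigenbases (`conjDiag`), so that trace inequalities
become scalar inequalities averaged over the doubly stochastic matrix of squared overlaps.

*Lower bound.* For a Hermitian `γ` of unit trace, `T = Tr|γ| ≥ 1`, and every `α > 1`, one has
`D̃_α(γ‖σ) ≥ D(|γ|/T ‖ σ)` (`relEntropy_abs_le_sandwiched`); thus the Gibbs bound for states also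
holds for Hermitian first arguments. With `1/α + 1/β = 1` and `c = 1/(2β)`, the three lines theorem
is applied to `F(z) = Tr[σ^{-zc} γ σ^{-zc} sgn(γ) |γ|^{z/β}]`. It equals `T` at `0`, and Hölder's
inequality bounds it by `T` on `Re z = 0` and by `‖σ^{-c} γ σ^{-c}‖_α T^{1/β}` on `Re z = 1`;
comparing derivatives at `0` gives the claim. The Gibbs principle then bounds the `s`-average of the
divergences below by `-ln Tr exp(∑ₓ sₓ ln(ρₓ + ε))` for every `ε > 0`, and this quantity is additive
on tensor powers, so the regularised bound obeys the same estimate.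

*Upper bound.* Let `C♭ < ∞`. For `ε > 0`, the Gibbs state at a maximiser `s` of
`-ln Tr exp(∑ₓ sₓ ln(ρₓ + ε))` has relative entropy at most `C♭` to every `ρₓ + ε` (`exists_state_forall_le`). Compactness yields
one state `τ` for all `ε`, whence `supp τ ≤ supp ρₓ` and `D(τ‖ρₓ) ≤ C♭` for all `x`
(`supp_le_and_relEntropy_le`). Klein's inequality for `t ↦ t ^ α` shows
`limsup_{α ↘ 1} D̃_α(τ‖ρₓ) ≤ D(τ‖ρₓ)` (`eventually_sandwiched_le`), and `τ^{⊗n}` serves for `n`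
copies because the divergence is additive.
-/

namespace StateExclusion

open scoped ComplexOrder
open Matrix

/-! ### Operators in an eigenbasis -/

section Eigenbasis

variable {B : Type*} [Fintype B]

/-- The squared overlaps `|⟨v_i, w_j⟩|²` of two orthonormal bases, given as the columns of the
unitaries `V` and `W`; they form a doubly stochastic matrix. -/
noncomputable def overlap (V W : Matrix B B ℂ) (i j : B) : ℝ :=
  ‖(Vᴴ * W) i j‖ ^ 2

lemma overlap_nonneg (V W : Matrix B B ℂ) (i j : B) : 0 ≤ overlap V W i j := by
  unfold overlap; positivity

lemma overlap_comm (V W : Matrix B B ℂ) (i j : B) : overlap V W i j = overlap W V j i := by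
  unfold overlap
  rw [show Wᴴ * V = (Vᴴ * W)ᴴ by simp, conjTranspose_apply, norm_star]

variable [DecidableEq B]

/-- The Hermitian operator with eigenvalues `d` and eigenvectors the columns of `V`
(which is meant to be unitary). -/
noncomputable def conjDiag (V : Matrix B B ℂ) (d : B → ℝ) : Matrix B B ℂ :=
  V * diagonal (fun i => (d i : ℂ)) * Vᴴ

lemma conjTranspose_mul_self_of_unitary {V : Matrix B B ℂ} (hV : V ∈ unitaryGroup B ℂ) :
    Vᴴ * V = 1 := by
  simpa [star_eq_conjTranspose] using mem_unitaryGroup_iff'.1 hV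

lemma mul_conjTranspose_self_of_unitary {V : Matrix B B ℂ} (hV : V ∈ unitaryGroup B ℂ) :
    V * Vᴴ = 1 := by
  simpa [star_eq_conjTranspose] using mem_unitaryGroup_iff.1 hV

lemma conjTranspose_mem_unitaryGroup {V : Matrix B B ℂ} (hV : V ∈ unitaryGroup B ℂ) :
    Vᴴ ∈ unitaryGroup B ℂ := by
  rw [mem_unitaryGroup_iff, star_eq_conjTranspose, conjTranspose_conjTranspose]
  exact conjTranspose_mul_self_of_unitary hV

lemma conjDiag_isHermitian (V : Matrix B B ℂ) (d : B → ℝ) : (conjDiag V d).IsHermitian := by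
  unfold conjDiag
  refine isHermitian_mul_mul_conjTranspose V ?_
  rw [isHermitian_diagonal_iff]
  intro i
  simp [IsSelfAdjoint]

lemma exists_eq_conjDiag {H : Matrix B B ℂ} (hH : H.IsHermitian) :
    ∃ V ∈ unitaryGroup B ℂ, ∃ d : B → ℝ, H = conjDiag V d :=
  ⟨hH.eigenvectorUnitary, hH.eigenvectorUnitary.2, hH.eigenvalues, by
    conv_lhs => rw [hH.spectral_theorem]
    rfl⟩

lemma exists_eq_conjDiag_of_posSemidef {H : Matrix B B ℂ} (hH : H.PosSemidef) :
    ∃ V ∈ unitaryGroup B ℂ, ∃ d : B → ℝ, (∀ i, 0 ≤ d i) ∧ H = conjDiag V d :=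
  ⟨hH.1.eigenvectorUnitary, hH.1.eigenvectorUnitary.2, hH.1.eigenvalues, hH.eigenvalues_nonneg, by
    conv_lhs => rw [hH.1.spectral_theorem]
    rfl⟩

lemma conjDiag_posSemidef (V : Matrix B B ℂ) {d : B → ℝ} (hd : ∀ i, 0 ≤ d i) :
    (conjDiag V d).PosSemidef := by
  unfold conjDiag
  refine PosSemidef.mul_mul_conjTranspose_same ?_ V
  rw [posSemidef_diagonal_iff]
  intro i
  exact_mod_cast hd i

/-- The functional calculus can be computed in any orthonormal eigenbasis. -/
lemma cfc_conjDiag {V : Matrix B B ℂ} (hV : V ∈ unitaryGroup B ℂ) (d : B → ℝ) (f : ℝ → ℝ) :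
    cfc f (conjDiag V d) = conjDiag V (fun i => f (d i)) := by
  obtain ⟨U, hU, u, hspec, hcfc⟩ : ∃ U ∈ unitaryGroup B ℂ, ∃ u : B → ℝ,
      conjDiag V d = conjDiag U u ∧ cfc f (conjDiag V d) = conjDiag U (fun i => f (u i)) := by
    have hH := conjDiag_isHermitian V d
    refine ⟨hH.eigenvectorUnitary, hH.eigenvectorUnitary.2, hH.eigenvalues, ?_, ?_⟩
    · conv_lhs => rw [hH.spectral_theorem]
      rfl
    · rw [hH.cfc_eq]
      rfl
  rw [hcfc]
  -- the change of basis intertwines the two diagonal forms, entry by entry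
  have hI : diagonal (fun i => (u i : ℂ)) * (Uᴴ * V)
      = (Uᴴ * V) * diagonal (fun i => (d i : ℂ)) := by
    have h1 : Uᴴ * conjDiag V d * V = Uᴴ * conjDiag U u * V := by rw [hspec]
    unfold conjDiag at h1
    have e1 : Uᴴ * (V * diagonal (fun i => (d i : ℂ)) * Vᴴ) * V
        = (Uᴴ * V) * diagonal (fun i => (d i : ℂ)) * (Vᴴ * V) := by
      simp only [Matrix.mul_assoc]
    have e2 : Uᴴ * (U * diagonal (fun i => (u i : ℂ)) * Uᴴ) * V
        = (Uᴴ * U) * diagonal (fun i => (u i : ℂ)) * (Uᴴ * V) := by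
      simp only [Matrix.mul_assoc]
    rw [e1, e2, conjTranspose_mul_self_of_unitary hU, conjTranspose_mul_self_of_unitary hV,
      Matrix.mul_one, Matrix.one_mul] at h1
    exact h1.symm
  have hJ : diagonal (fun i => (f (u i) : ℂ)) * (Uᴴ * V)
      = (Uᴴ * V) * diagonal (fun i => (f (d i) : ℂ)) := by
    ext i j
    have := congrFun (congrFun hI i) j
    rw [diagonal_mul, mul_diagonal] at this ⊢
    by_cases h0 : (Uᴴ * V) i j = 0
    · simp [h0]
    · rw [mul_comm] at this
      have h2 := mul_left_cancel₀ h0 this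
      have h3 : u i = d j := by exact_mod_cast h2
      rw [h3, mul_comm]
  unfold conjDiag
  calc U * diagonal (fun i => (f (u i) : ℂ)) * Uᴴ
      = U * (diagonal (fun i => (f (u i) : ℂ)) * (Uᴴ * V)) * Vᴴ := by
        simp only [Matrix.mul_assoc, mul_conjTranspose_self_of_unitary hV, Matrix.mul_one]
    _ = (U * Uᴴ) * V * diagonal (fun i => (f (d i) : ℂ)) * Vᴴ := by
        rw [hJ]; simp only [Matrix.mul_assoc]
    _ = _ := by rw [mul_conjTranspose_self_of_unitary hU, Matrix.one_mul]

lemma conjDiag_mul {V : Matrix B B ℂ} (hV : V ∈ unitaryGroup B ℂ) (d e : B → ℝ) :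
    conjDiag V d * conjDiag V e = conjDiag V (fun i => d i * e i) := by
  unfold conjDiag
  calc _ = V * diagonal (fun i => (d i : ℂ)) * (Vᴴ * V) * diagonal (fun i => (e i : ℂ)) * Vᴴ := by
        simp only [Matrix.mul_assoc]
    _ = _ := by
        rw [conjTranspose_mul_self_of_unitary hV, Matrix.mul_one, Matrix.mul_assoc V,
          diagonal_mul_diagonal]
        simp

lemma conjDiag_const {V : Matrix B B ℂ} (hV : V ∈ unitaryGroup B ℂ) (c : ℝ) :
    conjDiag V (fun _ => c) = c • (1 : Matrix B B ℂ) := by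
  unfold conjDiag
  have : diagonal (fun _ : B => (c : ℂ)) = c • (1 : Matrix B B ℂ) := by
    ext i j; by_cases h : i = j <;> simp [h]
  rw [this]
  simp [mul_conjTranspose_self_of_unitary hV]

lemma conjDiag_add (V : Matrix B B ℂ) (d e : B → ℝ) :
    conjDiag V d + conjDiag V e = conjDiag V (fun i => d i + e i) := by
  unfold conjDiag
  rw [← Matrix.add_mul, ← Matrix.mul_add, diagonal_add]
  simp

lemma smul_conjDiag (V : Matrix B B ℂ) (c : ℝ) (d : B → ℝ) :
    c • conjDiag V d = conjDiag V (fun i => c * d i) := by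
  unfold conjDiag
  have : diagonal (fun i : B => ((c * d i : ℝ) : ℂ)) = c • diagonal (fun i => (d i : ℂ)) := by
    ext i j; by_cases h : i = j <;> simp [h]
  rw [this]; simp

lemma trace_conjDiag {V : Matrix B B ℂ} (hV : V ∈ unitaryGroup B ℂ) (d : B → ℝ) :
    (conjDiag V d).trace = ((∑ i, d i : ℝ) : ℂ) := by
  unfold conjDiag
  rw [trace_mul_comm, ← Matrix.mul_assoc, conjTranspose_mul_self_of_unitary hV, Matrix.one_mul,
    trace_diagonal]
  push_cast; rfl

lemma trace_conjDiag_mul (V W : Matrix B B ℂ) (d e : B → ℝ) :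
    (conjDiag V d * conjDiag W e).trace = ((∑ i, ∑ j, overlap V W i j * (d i * e j) : ℝ) : ℂ) := by
  have h : (conjDiag V d * conjDiag W e).trace
      = (diagonal (fun i => (d i : ℂ)) * (Vᴴ * W) * diagonal (fun i => (e i : ℂ))
          * (Vᴴ * W)ᴴ).trace := by
    unfold conjDiag
    rw [conjTranspose_mul, conjTranspose_conjTranspose]
    rw [show V * diagonal (fun i => (d i : ℂ)) * Vᴴ * (W * diagonal (fun i => (e i : ℂ)) * Wᴴ)
      = V * (diagonal (fun i => (d i : ℂ)) * (Vᴴ * W) * diagonal (fun i => (e i : ℂ)) * Wᴴ) by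
        simp only [Matrix.mul_assoc], trace_mul_comm]
    simp only [Matrix.mul_assoc]
  rw [h, trace]
  push_cast
  refine Finset.sum_congr rfl fun i _ => ?_
  rw [diag_apply, mul_apply]
  refine Finset.sum_congr rfl fun j _ => ?_
  rw [mul_diagonal, diagonal_mul, conjTranspose_apply, overlap]
  have := Complex.mul_conj' ((Vᴴ * W) i j)
  push_cast
  rw [← this, Complex.star_def]
  ring

lemma sum_overlap_right {V W : Matrix B B ℂ} (hV : V ∈ unitaryGroup B ℂ)
    (hW : W ∈ unitaryGroup B ℂ) (i : B) : ∑ j, overlap V W i j = 1 := by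
  have h : ((Vᴴ * W) * (Vᴴ * W)ᴴ) = 1 := by
    rw [conjTranspose_mul, conjTranspose_conjTranspose, Matrix.mul_assoc, ← Matrix.mul_assoc W,
      mul_conjTranspose_self_of_unitary hW, Matrix.one_mul, conjTranspose_mul_self_of_unitary hV]
  have h2 := congrFun (congrFun h i) i
  rw [mul_apply, one_apply_eq] at h2
  have : ((∑ j, overlap V W i j : ℝ) : ℂ) = 1 := by
    rw [← h2]
    push_cast
    refine Finset.sum_congr rfl fun j _ => ?_
    rw [conjTranspose_apply, overlap, Complex.star_def, Complex.mul_conj']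
    push_cast; rfl
  exact_mod_cast this

lemma sum_overlap_left {V W : Matrix B B ℂ} (hV : V ∈ unitaryGroup B ℂ)
    (hW : W ∈ unitaryGroup B ℂ) (j : B) : ∑ i, overlap V W i j = 1 := by
  simp_rw [overlap_comm V W]
  exact sum_overlap_right hW hV j

/-- A sum over pairs of eigenvalues that only sees the first one collapses. -/
lemma sum_overlap_mul_left {V W : Matrix B B ℂ} (hV : V ∈ unitaryGroup B ℂ)
    (hW : W ∈ unitaryGroup B ℂ) (f : B → ℝ) :
    ∑ i, ∑ j, overlap V W i j * f i = ∑ i, f i := by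
  refine Finset.sum_congr rfl fun i _ => ?_
  rw [← Finset.sum_mul, sum_overlap_right hV hW, one_mul]

lemma sum_overlap_mul_right {V W : Matrix B B ℂ} (hV : V ∈ unitaryGroup B ℂ)
    (hW : W ∈ unitaryGroup B ℂ) (f : B → ℝ) :
    ∑ i, ∑ j, overlap V W i j * f j = ∑ j, f j := by
  rw [Finset.sum_comm]
  refine Finset.sum_congr rfl fun j _ => ?_
  rw [← Finset.sum_mul, sum_overlap_left hV hW, one_mul]

end Eigenbasis

/-! ### The Gibbs variational principle -/

section Gibbs

variable {B : Type*} [Fintype B] [DecidableEq B]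

/-- The partition function `Tr e^K` of a Hermitian operator. -/
noncomputable def expTrace (K : Matrix B B ℂ) : ℝ := (cfc Real.exp K).trace.re

lemma expTrace_conjDiag {V : Matrix B B ℂ} (hV : V ∈ unitaryGroup B ℂ) (d : B → ℝ) :
    expTrace (conjDiag V d) = ∑ i, Real.exp (d i) := by
  rw [expTrace, cfc_conjDiag hV, trace_conjDiag hV, Complex.ofReal_re]

lemma expTrace_pos [Nonempty B] {K : Matrix B B ℂ} (hK : K.IsHermitian) : 0 < expTrace K := by
  obtain ⟨V, hV, d, rfl⟩ := exists_eq_conjDiag hK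
  rw [expTrace_conjDiag hV]
  exact Finset.sum_pos (fun i _ => Real.exp_pos _) Finset.univ_nonempty

/-- The tangent-line inequality behind the Gibbs variational principle. -/
lemma sub_exp_le_mul_log_sub {x : ℝ} (hx : 0 ≤ x) (k : ℝ) :
    x - Real.exp k ≤ x * (Real.log x - k) := by
  rcases hx.eq_or_lt with rfl | hx
  · simp [Real.exp_nonneg]
  · have h := Real.add_one_le_exp (k - Real.log x)
    rw [Real.exp_sub, Real.exp_log hx, le_div_iff₀ hx] at h
    linarith

/-- Gibbs variational principle: the free energy of a state `∑ pᵢ |vᵢ⟩⟨vᵢ|` with respect to `K` is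
at least `-ln Tr e^K`. -/
lemma neg_log_expTrace_le [Nonempty B] {V : Matrix B B ℂ} (hV : V ∈ unitaryGroup B ℂ) {p : B → ℝ}
    (hp : ∀ i, 0 ≤ p i) (hp1 : ∑ i, p i = 1) {K : Matrix B B ℂ} (hK : K.IsHermitian) :
    -Real.log (expTrace K) ≤ ∑ i, p i * Real.log (p i) - (conjDiag V p * K).trace.re := by
  have hZ := expTrace_pos hK
  obtain ⟨W, hW, k, rfl⟩ := exists_eq_conjDiag hK
  set Z := expTrace (conjDiag W k) with hZdef
  have hZs : ∑ j, Real.exp (k j) = Z := (expTrace_conjDiag hW k).symm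
  rw [trace_conjDiag_mul, Complex.ofReal_re]
  have key : ∑ i, ∑ j, overlap V W i j * (p i - Real.exp (k j - Real.log Z))
      ≤ ∑ i, ∑ j, overlap V W i j * (p i * (Real.log (p i) - (k j - Real.log Z))) :=
    Finset.sum_le_sum fun i _ => Finset.sum_le_sum fun j _ =>
      mul_le_mul_of_nonneg_left (sub_exp_le_mul_log_sub (hp i) _) (overlap_nonneg V W i j)
  have h1 : ∑ i, ∑ j, overlap V W i j * (p i - Real.exp (k j - Real.log Z)) = 0 := by
    simp_rw [mul_sub, Finset.sum_sub_distrib]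
    rw [sum_overlap_mul_left hV hW, sum_overlap_mul_right hV hW, hp1]
    simp_rw [Real.exp_sub, Real.exp_log hZ]
    rw [← Finset.sum_div, hZs, div_self hZ.ne', sub_self]
  have h2 : ∑ i, ∑ j, overlap V W i j * (p i * (Real.log (p i) - (k j - Real.log Z)))
      = ∑ i, p i * Real.log (p i) - ∑ i, ∑ j, overlap V W i j * (p i * k j) + Real.log Z := by
    have : ∀ i j, overlap V W i j * (p i * (Real.log (p i) - (k j - Real.log Z)))
      = overlap V W i j * (p i * Real.log (p i) + p i * Real.log Z)
        - overlap V W i j * (p i * k j) := fun i j => by ring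
    simp_rw [this, Finset.sum_sub_distrib]
    rw [sum_overlap_mul_left hV hW, Finset.sum_add_distrib, ← Finset.sum_mul, hp1]
    ring
  rw [h1, h2] at key
  linarith

/-- Peierls–Bogoliubov inequality: `H ↦ ln Tr e^H` lies above its tangent at `H`. -/
lemma log_expTrace_add_le [Nonempty B] {H K : Matrix B B ℂ} (hH : H.IsHermitian)
    (hK : K.IsHermitian) :
    Real.log (expTrace H) + ((expTrace H)⁻¹ • (cfc Real.exp H) * (K - H)).trace.re
      ≤ Real.log (expTrace K) := by
  have hZ := expTrace_pos hH
  obtain ⟨V, hV, h, rfl⟩ := exists_eq_conjDiag hH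
  set Z := expTrace (conjDiag V h) with hZdef
  have hZs : ∑ j, Real.exp (h j) = Z := (expTrace_conjDiag hV h).symm
  rw [cfc_conjDiag hV, smul_conjDiag]
  have hp1 : ∑ i, Z⁻¹ * Real.exp (h i) = 1 := by
    rw [← Finset.mul_sum, hZs, inv_mul_cancel₀ hZ.ne']
  have h1 := neg_log_expTrace_le hV (p := fun i => Z⁻¹ * Real.exp (h i))
    (fun i => by positivity) hp1 hK
  rw [Matrix.mul_sub, trace_sub, Complex.sub_re, conjDiag_mul hV, trace_conjDiag hV,
    Complex.ofReal_re]
  have h2 : ∀ i, Real.log (Z⁻¹ * Real.exp (h i)) = h i - Real.log Z := fun i => by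
    rw [Real.log_mul (inv_ne_zero hZ.ne') (Real.exp_ne_zero _), Real.log_inv, Real.log_exp]; ring
  simp_rw [h2, mul_sub, Finset.sum_sub_distrib] at h1
  rw [← Finset.sum_mul, hp1] at h1
  linarith

end Gibbs

/-! ### Exponential sums on a strip -/

section ExponentialSums

variable {ι : Type*} [Fintype ι]

/-- Three lines theorem, in infinitesimal form at the left edge of the strip: an exponential sum
that is bounded by its value `T` at `0` on the line `Re z = 0` and by `N` on `Re z = 1` has
logarithmic derivative at most `ln N - ln T` at `0`. -/
lemma re_sum_mul_le_of_norm_le {C : ι → ℂ} {x : ι → ℝ} {T N : ℝ} (hT : 0 < T) (hN : 0 < N)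
    (h0 : ∑ q, C q = T)
    (hl : ∀ z : ℂ, z.re = 0 → ‖∑ q, C q * Complex.exp (z * x q)‖ ≤ T)
    (hr : ∀ z : ℂ, z.re = 1 → ‖∑ q, C q * Complex.exp (z * x q)‖ ≤ N) :
    (∑ q, C q * x q).re ≤ T * (Real.log N - Real.log T) := by
  set F : ℂ → ℂ := fun z => ∑ q, C q * Complex.exp (z * x q) with hF
  have hdiff : Differentiable ℂ F := by
    rw [hF]; fun_prop
  have hbdd : BddAbove ((norm ∘ F) '' Complex.HadamardThreeLines.verticalClosedStrip 0 1) := by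
    refine ⟨∑ q, ‖C q‖ * Real.exp |x q|, ?_⟩
    rintro _ ⟨z, hz, rfl⟩
    have hz' : 0 ≤ z.re ∧ z.re ≤ 1 := hz
    refine (norm_sum_le _ _).trans (Finset.sum_le_sum fun q _ => ?_)
    rw [norm_mul, Complex.norm_exp]
    refine mul_le_mul_of_nonneg_left (Real.exp_le_exp.2 ?_) (norm_nonneg _)
    have : (z * (x q : ℂ)).re = z.re * x q := by simp
    rw [this]
    calc z.re * x q ≤ |z.re * x q| := le_abs_self _
      _ = z.re * |x q| := by rw [abs_mul, abs_of_nonneg hz'.1]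
      _ ≤ 1 * |x q| := by gcongr; exact hz'.2
      _ = |x q| := one_mul _
  have hbound : ∀ t : ℝ, 0 ≤ t → t ≤ 1 → (F t).re ≤ T ^ (1 - t) * N ^ t := by
    intro t ht0 ht1
    have := Complex.HadamardThreeLines.norm_le_interp_of_mem_verticalClosedStrip' (f := F)
      (z := (t : ℂ)) (l := 0) (u := 1) one_pos ⟨by simpa using ht0, by simpa using ht1⟩
      hdiff.diffContOnCl hbdd (a := T) (b := N) (fun z hz => hl z hz) (fun z hz => hr z hz)
    simp only [sub_zero, div_one, Complex.ofReal_re] at this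
    exact (Complex.re_le_norm _).trans this
  -- the real functions `t ↦ Re F t` and `t ↦ T ^ (1 - t) * N ^ t` agree at `0`
  set φ : ℝ → ℝ := fun t => T ^ (1 - t) * N ^ t - (F t).re with hφ
  have hFd : HasDerivAt (fun t : ℝ => (F t).re) (∑ q, C q * x q).re 0 := by
    have h1 : HasDerivAt F (∑ q, C q * x q) ((0 : ℝ) : ℂ) := by
      rw [hF]
      refine HasDerivAt.fun_sum fun q _ => ?_
      have : HasDerivAt (fun z : ℂ => z * (x q : ℂ)) (x q : ℂ) ((0 : ℝ) : ℂ) := by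
        simpa using (hasDerivAt_id ((0 : ℝ) : ℂ)).mul_const (x q : ℂ)
      simpa using (this.cexp).const_mul (C q)
    exact h1.real_of_complex
  have hRd : HasDerivAt (fun t : ℝ => T ^ (1 - t) * N ^ t) (T * (Real.log N - Real.log T)) 0 := by
    have e : (fun t : ℝ => T ^ (1 - t) * N ^ t)
        = fun t : ℝ => Real.exp (Real.log T + t * (Real.log N - Real.log T)) := by
      funext t
      rw [Real.rpow_def_of_pos hT, Real.rpow_def_of_pos hN, ← Real.exp_add]
      congr 1; ring
    rw [e]
    have h1 : HasDerivAt (fun t : ℝ => Real.log T + t * (Real.log N - Real.log T))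
        (Real.log N - Real.log T) 0 := by
      simpa using ((hasDerivAt_id (0 : ℝ)).mul_const (Real.log N - Real.log T)).const_add
        (Real.log T)
    have h2 := h1.exp
    simpa [Real.exp_log hT] using h2
  have hφd : HasDerivAt φ (T * (Real.log N - Real.log T) - (∑ q, C q * x q).re) 0 := hRd.sub hFd
  have hφ0 : φ 0 = 0 := by
    simp only [hφ, hF, Complex.ofReal_zero, zero_mul, Complex.exp_zero, mul_one, h0,
      Complex.ofReal_re, sub_zero, Real.rpow_one, Real.rpow_zero, sub_self]
  by_contra! hcon
  have hneg : T * (Real.log N - Real.log T) - (∑ q, C q * x q).re < 0 := by linarith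
  have hslope := (hasDerivAt_iff_tendsto_slope.1 hφd).mono_left
    (nhdsWithin_mono 0 (fun t (ht : t ∈ Set.Ioi (0 : ℝ)) => (ne_of_gt ht : t ≠ 0)))
  have hev := hslope.eventually (eventually_lt_nhds hneg)
  have hev2 : ∀ᶠ t in 𝓝[>] (0 : ℝ), t ∈ Set.Ioc (0 : ℝ) 1 := Ioc_mem_nhdsGT one_pos
  obtain ⟨t, ht1, ht2⟩ := (hev.and hev2).exists
  rw [slope_def_field, hφ0, sub_zero, sub_zero] at ht1
  have hpos : 0 ≤ φ t := by
    have := hbound t ht2.1.le ht2.2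
    simp only [hφ]; linarith
  exact absurd ht1 (not_lt.2 (div_nonneg hpos ht2.1.le))

/-- The bound on the line `Re z = 1` in `re_sum_mul_le_of_norm_le` is automatically nonzero. -/
lemma pos_and_re_sum_mul_le_of_norm_le {C : ι → ℂ} {x : ι → ℝ} {T N : ℝ} (hT : 0 < T)
    (h0 : ∑ q, C q = T)
    (hl : ∀ z : ℂ, z.re = 0 → ‖∑ q, C q * Complex.exp (z * x q)‖ ≤ T)
    (hr : ∀ z : ℂ, z.re = 1 → ‖∑ q, C q * Complex.exp (z * x q)‖ ≤ N) :
    0 < N ∧ (∑ q, C q * x q).re ≤ T * (Real.log N - Real.log T) := by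
  have hN : 0 < N := by
    by_contra! hN
    -- a vanishing bound would make the derivative smaller than any real number
    have h := re_sum_mul_le_of_norm_le hT
      (Real.exp_pos (Real.log T + (∑ q, C q * x q).re / T - 1)) h0 hl
      (fun z hz => (hr z hz).trans (hN.trans (Real.exp_pos _).le))
    rw [Real.log_exp] at h
    have : T * (Real.log T + (∑ q, C q * x q).re / T - 1 - Real.log T)
        = (∑ q, C q * x q).re - T := by field_simp; ring
    linarith
  exact ⟨hN, re_sum_mul_le_of_norm_le hT hN h0 hl hr⟩

end ExponentialSums

/-! ### Hölder inequality for Schatten norms -/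

section Hoelder

variable {B : Type*} [Fintype B]

lemma sum_sum_mul_le_Lp_mul_Lq {w : B → B → ℝ} (hw : ∀ i j, 0 ≤ w i j)
    (hrow : ∀ i, ∑ j, w i j = 1) (hcol : ∀ j, ∑ i, w i j = 1) {g u : B → ℝ}
    (hg : ∀ i, 0 ≤ g i) (hu : ∀ j, 0 ≤ u j) {α β : ℝ} (hαβ : α.HolderConjugate β) :
    ∑ i, ∑ j, w i j * (g i * u j) ≤ (∑ i, g i ^ α) ^ (1 / α) * (∑ j, u j ^ β) ^ (1 / β) := by
  have hα := hαβ.pos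
  have hβ := hαβ.symm.pos
  have h := Real.inner_le_Lp_mul_Lq (Finset.univ : Finset (B × B))
    (fun q => w q.1 q.2 ^ (1 / α) * g q.1) (fun q => w q.1 q.2 ^ (1 / β) * u q.2) hαβ
  simp only [Fintype.sum_prod_type] at h
  have e1 : ∀ i j, w i j ^ (1 / α) * g i * (w i j ^ (1 / β) * u j) = w i j * (g i * u j) := by
    intro i j
    have : w i j ^ (1 / α) * w i j ^ (1 / β) = w i j := by
      rw [← Real.rpow_add_of_nonneg (hw i j) (by positivity) (by positivity), one_div, one_div,
        hαβ.inv_add_inv_eq_one, Real.rpow_one]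
    calc _ = (w i j ^ (1 / α) * w i j ^ (1 / β)) * (g i * u j) := by ring
      _ = _ := by rw [this]
  have e2 : ∀ i j, |w i j ^ (1 / α) * g i| ^ α = w i j * g i ^ α := by
    intro i j
    rw [abs_of_nonneg (mul_nonneg (Real.rpow_nonneg (hw i j) _) (hg i)),
      Real.mul_rpow (Real.rpow_nonneg (hw i j) _) (hg i), ← Real.rpow_mul (hw i j),
      one_div_mul_cancel hα.ne', Real.rpow_one]
  have e3 : ∀ i j, |w i j ^ (1 / β) * u j| ^ β = w i j * u j ^ β := by
    intro i j
    rw [abs_of_nonneg (mul_nonneg (Real.rpow_nonneg (hw i j) _) (hu j)),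
      Real.mul_rpow (Real.rpow_nonneg (hw i j) _) (hu j), ← Real.rpow_mul (hw i j),
      one_div_mul_cancel hβ.ne', Real.rpow_one]
  simp_rw [e1, e2, e3] at h
  rw [Finset.sum_comm (f := fun i j => w i j * u j ^ β)] at h
  simp_rw [← Finset.sum_mul, hrow, hcol, one_mul] at h
  exact h

variable [DecidableEq B]

/-- The trace of a Hermitian operator times a unitarily distorted diagonal operator is controlled
by doubly stochastic weights. -/
lemma norm_trace_mul_le {E' E S : Matrix B B ℂ} (hE' : E' ∈ unitaryGroup B ℂ)
    (hE : E ∈ unitaryGroup B ℂ) (hS : S ∈ unitaryGroup B ℂ) (g : B → ℝ) (u : B → ℂ) :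
    ∃ w : B → B → ℝ, (∀ i j, 0 ≤ w i j) ∧ (∀ i, ∑ j, w i j = 1) ∧ (∀ j, ∑ i, w i j = 1) ∧
      ‖(conjDiag E' g * (S * (E * diagonal u * Eᴴ) * S)).trace‖
        ≤ ∑ i, ∑ j, w i j * (|g i| * ‖u j‖) := by
  have hSE : S * E ∈ unitaryGroup B ℂ := mul_mem hS hE
  have hSE' : Sᴴ * E ∈ unitaryGroup B ℂ := mul_mem (conjTranspose_mem_unitaryGroup hS) hE
  refine ⟨fun i j => (overlap E' (S * E) i j + overlap (Sᴴ * E) E' j i) / 2, fun i j => ?_,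
    fun i => ?_, fun j => ?_, ?_⟩
  · have := overlap_nonneg E' (S * E) i j
    have := overlap_nonneg (Sᴴ * E) E' j i
    positivity
  · rw [← Finset.sum_div, Finset.sum_add_distrib, sum_overlap_right hE' hSE,
      sum_overlap_left hSE' hE']
    norm_num
  · rw [← Finset.sum_div, Finset.sum_add_distrib, sum_overlap_left hE' hSE,
      sum_overlap_right hSE' hE']
    norm_num
  · have h : (conjDiag E' g * (S * (E * diagonal u * Eᴴ) * S)).trace
        = ∑ i, ∑ j, (g i : ℂ) * (E'ᴴ * (S * E)) i j * (u j * ((Sᴴ * E)ᴴ * E') j i) := by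
      have h1 : (conjDiag E' g * (S * (E * diagonal u * Eᴴ) * S)).trace
          = ((diagonal (fun i => (g i : ℂ)) * (E'ᴴ * (S * E)))
            * (diagonal u * ((Sᴴ * E)ᴴ * E'))).trace := by
        unfold conjDiag
        rw [conjTranspose_mul, conjTranspose_conjTranspose]
        rw [show E' * diagonal (fun i => (g i : ℂ)) * E'ᴴ * (S * (E * diagonal u * Eᴴ) * S)
          = E' * (diagonal (fun i => (g i : ℂ)) * (E'ᴴ * (S * E)) * (diagonal u * (Eᴴ * S))) by
            simp only [Matrix.mul_assoc], trace_mul_comm]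
        simp only [Matrix.mul_assoc]
      rw [h1, trace]
      refine Finset.sum_congr rfl fun i _ => ?_
      rw [diag_apply, mul_apply]
      refine Finset.sum_congr rfl fun j _ => ?_
      rw [diagonal_mul, diagonal_mul]
    rw [h]
    refine (norm_sum_le _ _).trans (Finset.sum_le_sum fun i _ =>
      (norm_sum_le _ _).trans (Finset.sum_le_sum fun j _ => ?_))
    simp only [norm_mul, Complex.norm_real, Real.norm_eq_abs, overlap]
    have h2 := two_mul_le_add_sq ‖(E'ᴴ * (S * E)) i j‖ ‖((Sᴴ * E)ᴴ * E') j i‖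
    have h3 : 0 ≤ |g i| * ‖u j‖ := by positivity
    nlinarith [mul_le_mul_of_nonneg_right h2 h3]

lemma norm_trace_mul_le_sum_abs {E' E S : Matrix B B ℂ} (hE' : E' ∈ unitaryGroup B ℂ)
    (hE : E ∈ unitaryGroup B ℂ) (hS : S ∈ unitaryGroup B ℂ) (g : B → ℝ) {u : B → ℂ}
    (hu : ∀ j, ‖u j‖ ≤ 1) :
    ‖(conjDiag E' g * (S * (E * diagonal u * Eᴴ) * S)).trace‖ ≤ ∑ i, |g i| := by
  obtain ⟨w, hw, hrow, -, h⟩ := norm_trace_mul_le hE' hE hS g u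
  refine h.trans (Finset.sum_le_sum fun i _ => ?_)
  calc ∑ j, w i j * (|g i| * ‖u j‖) ≤ ∑ j, w i j * |g i| :=
        Finset.sum_le_sum fun j _ => mul_le_mul_of_nonneg_left
          (mul_le_of_le_one_right (abs_nonneg _) (hu j)) (hw i j)
    _ = |g i| := by rw [← Finset.sum_mul, hrow, one_mul]

lemma norm_trace_mul_le_Lp_mul_Lq {E' E S : Matrix B B ℂ} (hE' : E' ∈ unitaryGroup B ℂ)
    (hE : E ∈ unitaryGroup B ℂ) (hS : S ∈ unitaryGroup B ℂ) (g : B → ℝ) (u : B → ℂ) {α β : ℝ}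
    (hαβ : α.HolderConjugate β) :
    ‖(conjDiag E' g * (S * (E * diagonal u * Eᴴ) * S)).trace‖
      ≤ (∑ i, |g i| ^ α) ^ (1 / α) * (∑ j, ‖u j‖ ^ β) ^ (1 / β) := by
  obtain ⟨w, hw, hrow, hcol, h⟩ := norm_trace_mul_le hE' hE hS g u
  exact h.trans (sum_sum_mul_le_Lp_mul_Lq hw hrow hcol (fun i => abs_nonneg _)
    (fun j => norm_nonneg _) hαβ)

end Hoelder

/-! ### Lower bound on the extended sandwiched divergence -/

section SandwichedLower

variable {B : Type*} [Fintype B] [DecidableEq B]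

lemma conj_diagonal_mem_unitaryGroup {V : Matrix B B ℂ} (hV : V ∈ unitaryGroup B ℂ) {a : B → ℂ}
    (ha : ∀ k, ‖a k‖ = 1) : V * diagonal a * Vᴴ ∈ unitaryGroup B ℂ := by
  refine mul_mem (mul_mem hV ?_) (conjTranspose_mem_unitaryGroup hV)
  rw [mem_unitaryGroup_iff, star_eq_conjTranspose, diagonal_conjTranspose, diagonal_mul_diagonal]
  rw [← diagonal_one]
  congr 1
  funext k
  rw [Pi.star_apply, Complex.star_def, Complex.mul_conj', ha]
  norm_num

lemma trace_mul_expansion (W E γ : Matrix B B ℂ) (a u : B → ℂ) :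
    (γ * ((W * diagonal a * Wᴴ) * (E * diagonal u * Eᴴ) * (W * diagonal a * Wᴴ))).trace
      = ∑ k, ∑ l, ∑ i, (Wᴴ * γ * W) k l * (Wᴴ * E) l i * star ((Wᴴ * E) k i)
          * (a k * a l * u i) := by
  have h1 : (γ * ((W * diagonal a * Wᴴ) * (E * diagonal u * Eᴴ) * (W * diagonal a * Wᴴ))).trace
      = ((Wᴴ * γ * W) * (diagonal a * ((Wᴴ * E) * diagonal u * (Wᴴ * E)ᴴ) * diagonal a)).trace := by
    rw [conjTranspose_mul, conjTranspose_conjTranspose]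
    rw [show γ * ((W * diagonal a * Wᴴ) * (E * diagonal u * Eᴴ) * (W * diagonal a * Wᴴ))
      = (γ * W * diagonal a * Wᴴ * E * diagonal u * Eᴴ * W * diagonal a) * Wᴴ by
        simp only [Matrix.mul_assoc], trace_mul_comm]
    simp only [Matrix.mul_assoc]
  rw [h1, trace]
  generalize Wᴴ * γ * W = Γ
  generalize Wᴴ * E = M
  refine Finset.sum_congr rfl fun k _ => ?_
  rw [diag_apply, mul_apply]
  refine Finset.sum_congr rfl fun l _ => ?_
  rw [mul_diagonal, diagonal_mul, mul_apply, Finset.mul_sum, Finset.sum_mul, Finset.mul_sum]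
  refine Finset.sum_congr rfl fun i _ => ?_
  rw [mul_diagonal, conjTranspose_apply]
  ring

/-- Interpolation estimate for a Hermitian operator `γ = E diag(g) E†`: with `R = e^{-cL}`, the
Schatten `α`-norm of `R γ R` bounds the derivative at `0` of
`z ↦ Tr[e^{-zcL} γ e^{-zcL} sgn(γ) |γ|^{z/β}]`. -/
lemma interpolation_estimate {W E E' : Matrix B B ℂ} (hW : W ∈ unitaryGroup B ℂ)
    (hE : E ∈ unitaryGroup B ℂ) (hE' : E' ∈ unitaryGroup B ℂ) {ℓ g g' : B → ℝ} {α β c T : ℝ}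
    (hαβ : α.HolderConjugate β) (hT : ∑ i, |g i| = T) (hT0 : 0 < T)
    (hG : conjDiag W (fun k => Real.exp (-(c * ℓ k))) * conjDiag E g
      * conjDiag W (fun k => Real.exp (-(c * ℓ k))) = conjDiag E' g') :
    0 < (∑ i, |g' i| ^ α) ^ (1 / α) * T ^ (1 / β) ∧
    ∑ k, ∑ i, overlap W E k i * (|g i| * (-(2 * c * ℓ k) + Real.log |g i| / β))
      ≤ T * (Real.log ((∑ i, |g' i| ^ α) ^ (1 / α) * T ^ (1 / β)) - Real.log T) := by
  have hβ := hαβ.symm.pos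
  set M := Wᴴ * E with hM
  have hMu : M ∈ unitaryGroup B ℂ := mul_mem (conjTranspose_mem_unitaryGroup hW) hE
  -- the signs of the eigenvalues of `γ`, with value `0 / 0 = 0` on its kernel
  set s : B → ℝ := fun i => g i / |g i| with hs
  have hgs : ∀ i, g i * s i = |g i| := fun i => by
    by_cases h0 : g i = 0
    · simp [h0]
    · simp only [hs]
      rw [← mul_div_assoc, ← abs_mul_abs_self, mul_div_assoc, div_self (abs_ne_zero.2 h0), mul_one]
  have hs1 : ∀ i, |s i| ≤ 1 := fun i => by
    simp only [hs, abs_div, abs_abs]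
    exact div_self_le_one _
  -- the overlaps of the eigenbasis `E` diagonalise the two partial sums over `k` and over `l`
  set Γ := Wᴴ * conjDiag E g * W with hΓ
  have hΓM : Γ = conjDiag M g := by
    rw [hΓ, hM, conjDiag, conjDiag, conjTranspose_mul, conjTranspose_conjTranspose]
    simp only [Matrix.mul_assoc]
  have hΓh : Γ.IsHermitian := hΓM ▸ conjDiag_isHermitian M g
  have hΓM' : ∀ k i, ∑ l, Γ k l * M l i = M k i * g i := by
    intro k i
    rw [← mul_apply, hΓM, conjDiag, Matrix.mul_assoc, conjTranspose_mul_self_of_unitary hMu,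
      Matrix.mul_one, mul_diagonal]
  have hΓM'' : ∀ l i, ∑ k, Γ k l * star (M k i) = star (M l i) * g i := by
    intro l i
    have := congrArg star (hΓM' l i)
    rw [star_sum, star_mul', show star (g i : ℂ) = g i from Complex.conj_ofReal _] at this
    rw [← this]
    refine Finset.sum_congr rfl fun k _ => ?_
    rw [star_mul', hΓh.apply]
  set C : B × B × B → ℂ := fun q => Γ q.1 q.2.1 * M q.2.1 q.2.2 * star (M q.1 q.2.2) * s q.2.2
    with hC
  set x : B × B × B → ℝ := fun q => -(c * ℓ q.1) + -(c * ℓ q.2.1) + Real.log |g q.2.2| / β with hx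
  have hov : ∀ k i, M k i * star (M k i) = (overlap W E k i : ℂ) := by
    intro k i
    rw [Complex.star_def, Complex.mul_conj', overlap]
    push_cast; rfl
  have hSum : ∀ (a b : B → ℝ), ∑ q : B × B × B, C q * ((a q.1 + a q.2.1 + b q.2.2 : ℝ) : ℂ)
      = ((∑ k, ∑ i, overlap W E k i * (|g i| * (2 * a k + b i)) : ℝ) : ℂ) := by
    intro a b
    have hA : ∀ f : B → B → ℂ, ∑ k, ∑ l, ∑ i, Γ k l * M l i * star (M k i) * s i * f k i
        = ∑ k, ∑ i, (overlap W E k i : ℂ) * |g i| * f k i := by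
      intro f
      refine Finset.sum_congr rfl fun k _ => ?_
      rw [Finset.sum_comm]
      refine Finset.sum_congr rfl fun i _ => ?_
      rw [← hov, ← hgs]
      calc _ = (∑ l, Γ k l * M l i) * (star (M k i) * s i * f k i) := by
            rw [Finset.sum_mul]; exact Finset.sum_congr rfl fun l _ => by ring
        _ = _ := by rw [hΓM']; push_cast; ring
    have hB : ∀ f : B → B → ℂ, ∑ k, ∑ l, ∑ i, Γ k l * M l i * star (M k i) * s i * f l i
        = ∑ k, ∑ i, (overlap W E k i : ℂ) * |g i| * f k i := by
      intro f
      rw [Finset.sum_comm]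
      refine Finset.sum_congr rfl fun l _ => ?_
      rw [Finset.sum_comm]
      refine Finset.sum_congr rfl fun i _ => ?_
      rw [← hov, ← hgs]
      calc _ = (∑ k, Γ k l * star (M k i)) * (M l i * s i * f l i) := by
            rw [Finset.sum_mul]; exact Finset.sum_congr rfl fun l _ => by ring
        _ = _ := by rw [hΓM'']; push_cast; ring
    simp only [Fintype.sum_prod_type, hC]
    have e : ∀ k l i, Γ k l * M l i * star (M k i) * s i * ((a k + a l + b i : ℝ) : ℂ)
        = Γ k l * M l i * star (M k i) * s i * (a k + b i : ℂ)
          + Γ k l * M l i * star (M k i) * s i * (a l : ℂ) := by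
      intro k l i; push_cast; ring
    simp_rw [e, Finset.sum_add_distrib]
    rw [hA (fun k i => (a k + b i : ℂ)), hB (fun k _ => (a k : ℂ)), ← Finset.sum_add_distrib]
    push_cast
    refine Finset.sum_congr rfl fun k _ => ?_
    rw [← Finset.sum_add_distrib]
    exact Finset.sum_congr rfl fun i _ => by ring
  have h0 : ∑ q, C q = T := by
    have := hSum (fun _ => 0) (fun _ => 1)
    simp only [add_zero, zero_add, Complex.ofReal_one, mul_one, mul_zero] at this
    rw [this, sum_overlap_mul_right hW hE, hT]
  set S : ℂ → Matrix B B ℂ :=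
    fun z => W * diagonal (fun k => Complex.exp (z * (-(c * ℓ k) : ℝ))) * Wᴴ with hSdef
  set u : ℂ → B → ℂ := fun z i => s i * Complex.exp (z * (Real.log |g i| / β : ℝ)) with hu
  have hF : ∀ z : ℂ, ∑ q, C q * Complex.exp (z * x q)
      = (conjDiag E g * (S z * (E * diagonal (u z) * Eᴴ) * S z)).trace := by
    intro z
    rw [hSdef, trace_mul_expansion]
    simp only [Fintype.sum_prod_type, hC, hx]
    refine Finset.sum_congr rfl fun k _ => Finset.sum_congr rfl fun l _ =>
      Finset.sum_congr rfl fun i _ => ?_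
    have : Complex.exp (z * ((-(c * ℓ k) + -(c * ℓ l) + Real.log |g i| / β : ℝ) : ℂ))
        = Complex.exp (z * (-(c * ℓ k) : ℝ)) * Complex.exp (z * (-(c * ℓ l) : ℝ))
          * Complex.exp (z * (Real.log |g i| / β : ℝ)) := by
      rw [← Complex.exp_add, ← Complex.exp_add]
      congr 1; push_cast; ring
    rw [this]
    simp only [hu]
    ring
  have hl : ∀ z : ℂ, z.re = 0 → ‖∑ q, C q * Complex.exp (z * x q)‖ ≤ T := by
    intro z hz
    rw [hF, ← hT]
    refine norm_trace_mul_le_sum_abs hE hE (conj_diagonal_mem_unitaryGroup hW fun k => ?_) g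
      fun j => ?_
    · rw [Complex.norm_exp]; simp [hz]
    · simp only [hu]
      rw [norm_mul, Complex.norm_exp, Complex.norm_real, Real.norm_eq_abs]
      simpa [hz] using hs1 j
  have hr : ∀ z : ℂ, z.re = 1 → ‖∑ q, C q * Complex.exp (z * x q)‖
      ≤ (∑ i, |g' i| ^ α) ^ (1 / α) * T ^ (1 / β) := by
    intro z hz
    rw [hF]
    -- split the diagonal factor into its modulus, absorbed in `G`, and a unitary phase
    have hsplit : ∀ k, Complex.exp (z * (-(c * ℓ k) : ℝ))
        = (Real.exp (-(c * ℓ k)) : ℂ)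
          * Complex.exp (((z.im : ℂ) * Complex.I) * (-(c * ℓ k) : ℝ)) := by
      intro k
      rw [Complex.ofReal_exp, ← Complex.exp_add]
      congr 1
      conv_lhs => rw [← Complex.re_add_im z, hz]
      push_cast; ring
    set R := conjDiag W (fun k => Real.exp (-(c * ℓ k))) with hR
    set U := W * diagonal (fun k => Complex.exp (((z.im : ℂ) * Complex.I) * (-(c * ℓ k) : ℝ))) * Wᴴ
      with hU
    have hUu : U ∈ unitaryGroup B ℂ := conj_diagonal_mem_unitaryGroup hW fun k => by
      rw [Complex.norm_exp]; simp
    have hWW := conjTranspose_mul_self_of_unitary hW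
    have hS1 : S z = R * U := by
      rw [hR, hU, conjDiag]
      calc S z = W * (diagonal (fun k => (Real.exp (-(c * ℓ k)) : ℂ)) * diagonal (fun k =>
            Complex.exp (((z.im : ℂ) * Complex.I) * (-(c * ℓ k) : ℝ)))) * Wᴴ := by
            rw [diagonal_mul_diagonal]; simp only [hSdef, hsplit]
        _ = W * diagonal (fun k => (Real.exp (-(c * ℓ k)) : ℂ)) * (Wᴴ * W) * diagonal (fun k =>
            Complex.exp (((z.im : ℂ) * Complex.I) * (-(c * ℓ k) : ℝ))) * Wᴴ := by
            rw [hWW, Matrix.mul_one]; simp only [Matrix.mul_assoc]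
        _ = _ := by simp only [Matrix.mul_assoc]
    have hS2 : S z = U * R := by
      rw [hR, hU, conjDiag]
      calc S z = W * (diagonal (fun k => Complex.exp (((z.im : ℂ) * Complex.I) * (-(c * ℓ k) : ℝ)))
            * diagonal (fun k => (Real.exp (-(c * ℓ k)) : ℂ))) * Wᴴ := by
            rw [diagonal_mul_diagonal]; simp only [hSdef, hsplit, mul_comm]
        _ = W * diagonal (fun k => Complex.exp (((z.im : ℂ) * Complex.I) * (-(c * ℓ k) : ℝ)))
            * (Wᴴ * W) * diagonal (fun k => (Real.exp (-(c * ℓ k)) : ℂ)) * Wᴴ := by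
            rw [hWW, Matrix.mul_one]; simp only [Matrix.mul_assoc]
        _ = _ := by simp only [Matrix.mul_assoc]
    have htr : (conjDiag E g * (S z * (E * diagonal (u z) * Eᴴ) * S z)).trace
        = (conjDiag E' g' * (U * (E * diagonal (u z) * Eᴴ) * U)).trace := by
      rw [← hG]
      nth_rewrite 2 [hS2]
      rw [hS1]
      rw [show conjDiag E g * (R * U * (E * diagonal (u z) * Eᴴ) * (U * R))
        = (conjDiag E g * R * (U * (E * diagonal (u z) * Eᴴ) * U)) * R by
          simp only [Matrix.mul_assoc], trace_mul_comm]
      simp only [Matrix.mul_assoc]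
    rw [htr]
    refine (norm_trace_mul_le_Lp_mul_Lq hE' hE hUu g' (u z) hαβ).trans (le_of_eq ?_)
    congr 2
    rw [← hT]
    refine Finset.sum_congr rfl fun j _ => ?_
    simp only [hu]
    rw [norm_mul, Complex.norm_exp, Complex.norm_real, Real.norm_eq_abs]
    by_cases h0 : g j = 0
    · simp [hs, h0, Real.zero_rpow hβ.ne']
    · have h1 : |s j| = 1 := by
        simp only [hs, abs_div, abs_abs]
        exact div_self (abs_ne_zero.2 h0)
      have h2 : (z * ((Real.log |g j| / β : ℝ) : ℂ)).re = Real.log |g j| / β := by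
        rw [Complex.re_mul_ofReal, hz, one_mul]
      rw [h1, h2, one_mul, ← Real.exp_mul, div_mul_cancel₀ _ hβ.ne',
        Real.exp_log (abs_pos.2 h0)]
  obtain ⟨hN, h⟩ := pos_and_re_sum_mul_le_of_norm_le hT0 h0 hl hr
  refine ⟨hN, ?_⟩
  have h2 := hSum (fun k => -(c * ℓ k)) (fun i => Real.log |g i| / β)
  rw [show (∑ q, C q * (x q : ℂ)) = _ from h2, Complex.ofReal_re] at h
  refine le_trans (le_of_eq ?_) h
  refine Finset.sum_congr rfl fun k _ => Finset.sum_congr rfl fun i _ => ?_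
  ring

lemma schattenNorm_conjDiag_rpow {V : Matrix B B ℂ} (hV : V ∈ unitaryGroup B ℂ) (g : B → ℝ)
    {α : ℝ} (hα : 0 < α) : schattenNorm α (conjDiag V g) ^ α = ∑ i, |g i| ^ α := by
  have h1 : ∀ i, (g i * g i) ^ (α / 2) = |g i| ^ α := fun i => by
    rw [← abs_mul_abs_self, ← sq, ← Real.rpow_natCast, ← Real.rpow_mul (abs_nonneg _)]
    congr 1; push_cast; ring
  rw [schattenNorm, (conjDiag_isHermitian V g).eq, conjDiag_mul hV, cfc_conjDiag hV,
    trace_conjDiag hV, Complex.ofReal_re, ← Real.rpow_mul, one_div_mul_cancel hα.ne', Real.rpow_one]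
  · simp_rw [h1]
  · exact Finset.sum_nonneg fun i _ => by rw [h1]; positivity

lemma suppPow_conjDiag {W : Matrix B B ℂ} (hW : W ∈ unitaryGroup B ℂ) (r : B → ℝ) (p : ℝ) :
    suppPow (conjDiag W r) p = conjDiag W (fun k => r k ^ p) := cfc_conjDiag hW r _

omit [DecidableEq B] in
/-- Range inclusion is divisibility. -/
lemma supp_le_iff (γ σ : Matrix B B ℂ) : supp γ ≤ supp σ ↔ ∃ X, γ = σ * X := by
  classical
  constructor
  · intro h
    have : ∀ j, ∃ v, σ *ᵥ v = γ *ᵥ Pi.single j 1 := fun j => h ⟨Pi.single j 1, rfl⟩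
    choose v hv using this
    refine ⟨of fun i j => v j i, ?_⟩
    ext i j
    have := congrFun (hv j) i
    rw [mulVec_single_one] at this
    exact this.symm
  · rintro ⟨X, rfl⟩ _ ⟨v, rfl⟩
    exact ⟨X *ᵥ v, by simp⟩

/-- Only the values on the support of `σ` matter for functions of `σ` acting on an operator
supported there. -/
lemma conjDiag_mul_congr {W γ : Matrix B B ℂ} (hW : W ∈ unitaryGroup B ℂ) {r f₁ f₂ : B → ℝ}
    (hsupp : supp γ ≤ supp (conjDiag W r)) (hf : ∀ k, r k ≠ 0 → f₁ k = f₂ k) :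
    conjDiag W f₁ * γ = conjDiag W f₂ * γ := by
  obtain ⟨X, rfl⟩ := (supp_le_iff _ _).1 hsupp
  rw [← Matrix.mul_assoc, ← Matrix.mul_assoc, conjDiag_mul hW, conjDiag_mul hW]
  congr 2
  funext k
  by_cases h : r k = 0
  · simp [h]
  · rw [hf k h]

lemma mul_conjDiag_congr {W γ : Matrix B B ℂ} (hW : W ∈ unitaryGroup B ℂ) {r f₁ f₂ : B → ℝ}
    (hγ : γ.IsHermitian) (hsupp : supp γ ≤ supp (conjDiag W r))
    (hf : ∀ k, r k ≠ 0 → f₁ k = f₂ k) : γ * conjDiag W f₁ = γ * conjDiag W f₂ := by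
  have := congrArg conjTranspose (conjDiag_mul_congr hW hsupp hf)
  rwa [conjTranspose_mul, conjTranspose_mul, hγ.eq, (conjDiag_isHermitian _ _).eq,
    (conjDiag_isHermitian _ _).eq] at this

lemma overlap_mul_eq_zero {W E : Matrix B B ℂ} (hW : W ∈ unitaryGroup B ℂ)
    (hE : E ∈ unitaryGroup B ℂ) {r g : B → ℝ} (hsupp : supp (conjDiag E g) ≤ supp (conjDiag W r))
    {k : B} (hk : r k = 0) (i : B) : overlap W E k i * g i = 0 := by
  have h := conjDiag_mul_congr hW hsupp (f₁ := fun j => if r j = 0 then 1 else 0)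
    (f₂ := fun _ => 0) (fun j hj => by simp [hj])
  have h2 := congrArg (fun A => (Wᴴ * A * E) k i) h
  have e : ∀ f : B → ℝ, Wᴴ * (conjDiag W f * conjDiag E g) * E
      = diagonal (fun j => (f j : ℂ)) * (Wᴴ * E) * diagonal (fun j => (g j : ℂ)) := by
    intro f
    unfold conjDiag
    calc _ = (Wᴴ * W) * diagonal (fun j => (f j : ℂ)) * Wᴴ * E * diagonal (fun j => (g j : ℂ))
          * (Eᴴ * E) := by simp only [Matrix.mul_assoc]
      _ = _ := by
        rw [conjTranspose_mul_self_of_unitary hW, conjTranspose_mul_self_of_unitary hE,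
          Matrix.one_mul, Matrix.mul_one]
        simp only [Matrix.mul_assoc]
  simp only [e] at h2
  rw [mul_diagonal, mul_diagonal, diagonal_mul, diagonal_mul] at h2
  simp only [hk, if_true, Complex.ofReal_one, one_mul, Complex.ofReal_zero, zero_mul,
    mul_eq_zero, Complex.ofReal_eq_zero] at h2
  rcases h2 with h2 | h2
  · simp [overlap, h2]
  · simp [h2]

/-- The extended sandwiched divergence of a Hermitian operator of unit trace dominates the Umegaki
relative entropy of its normalised absolute value. -/
lemma relEntropy_abs_le_sandwiched {W E : Matrix B B ℂ} (hW : W ∈ unitaryGroup B ℂ)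
    (hE : E ∈ unitaryGroup B ℂ) {r g : B → ℝ} (hr : ∀ k, 0 ≤ r k) (hg : ∑ i, g i = 1)
    (hsupp : supp (conjDiag E g) ≤ supp (conjDiag W r)) {α : ℝ} (hα : 1 < α) {p : B → ℝ}
    (hp : ∀ i, p i = |g i| / ∑ j, |g j|) :
    ∑ i, p i * Real.log (p i) - ∑ k, ∑ i, overlap W E k i * (p i * Real.log (r k))
      ≤ 1 / (α - 1) * Real.log (schattenNorm α (suppPow (conjDiag W r) ((1 - α) / (2 * α)) *
        conjDiag E g * suppPow (conjDiag W r) ((1 - α) / (2 * α))) ^ α) := by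
  have hα0 : 0 < α := by linarith
  have hα1 : 0 < α - 1 := by linarith
  set β := α.conjExponent with hβdef
  have hαβ : α.HolderConjugate β := Real.HolderConjugate.conjExponent hα
  have hβ := hαβ.symm.pos
  have hβα : β = α / (α - 1) := rfl
  set c := 1 / (2 * β) with hc
  have hcα : (1 - α) / (2 * α) = -c := by
    rw [hc, hβα]; field_simp; ring
  set T := ∑ j, |g j| with hT
  have hT1 : 1 ≤ T := by
    rw [← hg, hT]
    exact Finset.sum_le_sum fun i _ => le_abs_self _
  have hT0 : 0 < T := by linarith
  have hlogT : 0 ≤ Real.log T := Real.log_nonneg hT1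
  -- since `Real.log 0 = 0`, the exponential below equals `1` on the kernel of `σ`, which is
  -- harmless because `γ` is supported on the support of `σ`
  have hpow : ∀ k, r k ≠ 0 → r k ^ (-c) = Real.exp (-(c * Real.log (r k))) := fun k hk => by
    rw [Real.rpow_def_of_pos (lt_of_le_of_ne (hr k) hk.symm)]
    congr 1; ring
  have hGeq : suppPow (conjDiag W r) ((1 - α) / (2 * α)) * conjDiag E g
      * suppPow (conjDiag W r) ((1 - α) / (2 * α))
      = conjDiag W (fun k => Real.exp (-(c * Real.log (r k)))) * conjDiag E g
        * conjDiag W (fun k => Real.exp (-(c * Real.log (r k)))) := by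
    rw [hcα, suppPow_conjDiag hW, conjDiag_mul_congr hW hsupp hpow, Matrix.mul_assoc,
      mul_conjDiag_congr hW (conjDiag_isHermitian E g) hsupp hpow, Matrix.mul_assoc]
  have hGh : (conjDiag W (fun k => Real.exp (-(c * Real.log (r k)))) * conjDiag E g
      * conjDiag W (fun k => Real.exp (-(c * Real.log (r k))))).IsHermitian := by
    have := isHermitian_mul_mul_conjTranspose
      (conjDiag W (fun k => Real.exp (-(c * Real.log (r k))))) (conjDiag_isHermitian E g)
    rwa [(conjDiag_isHermitian W _).eq] at this
  obtain ⟨E', hE', g', hG⟩ := exists_eq_conjDiag hGh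
  rw [hGeq, hG, schattenNorm_conjDiag_rpow hE' _ hα0]
  obtain ⟨hN, h⟩ := interpolation_estimate hW hE hE' hαβ hT.symm hT0 hG
  set Q := ∑ i, |g' i| ^ α with hQ
  have hQ0 : 0 < Q := by
    have hQ' : 0 ≤ Q := Finset.sum_nonneg fun i _ => Real.rpow_nonneg (abs_nonneg (g' i)) α
    rcases hQ'.eq_or_lt with h0 | h0
    · rw [← h0, Real.zero_rpow (by positivity), zero_mul] at hN
      exact absurd hN (lt_irrefl 0)
    · exact h0
  rw [Real.log_mul (Real.rpow_pos_of_pos hQ0 _).ne' (Real.rpow_pos_of_pos hT0 _).ne',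
    Real.log_rpow hQ0, Real.log_rpow hT0] at h
  have hgp : ∀ i, |g i| = T * p i := fun i => by rw [hp]; field_simp
  have hp1 : ∑ i, p i = 1 := by
    simp_rw [hp]; rw [← Finset.sum_div]; exact div_self hT0.ne'
  have hterm : ∀ k i, overlap W E k i * (|g i| * (-(2 * c * Real.log (r k)) + Real.log |g i| / β))
      = T / β * (overlap W E k i * (p i * Real.log (p i) + p i * Real.log T)
        - overlap W E k i * (p i * Real.log (r k))) := by
    intro k i
    rw [hgp]
    by_cases h0 : p i = 0
    · simp [h0]
    · rw [Real.log_mul hT0.ne' h0, hc]; field_simp; ring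
  simp_rw [hterm, ← Finset.mul_sum, Finset.sum_sub_distrib] at h
  rw [sum_overlap_mul_right hW hE (fun i => p i * Real.log (p i) + p i * Real.log T),
    Finset.sum_add_distrib, ← Finset.sum_mul, hp1, one_mul] at h
  set D1 := ∑ i, p i * Real.log (p i)
  set D2 := ∑ k, ∑ i, overlap W E k i * (p i * Real.log (r k))
  have h3 : D1 + Real.log T - D2 ≤ β * (1 / α * Real.log Q + 1 / β * Real.log T - Real.log T) := by
    have h4 : T / β * (D1 + Real.log T - D2) ≤ T / β * (β * (1 / α * Real.log Q
        + 1 / β * Real.log T - Real.log T)) := by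
      refine h.trans (le_of_eq ?_)
      field_simp
    exact le_of_mul_le_mul_left h4 (by positivity)
  have h5 : β * (1 / α * Real.log Q + 1 / β * Real.log T - Real.log T)
      = 1 / (α - 1) * Real.log Q + Real.log T - β * Real.log T := by
    rw [hβα]; field_simp
  have h6 : 0 ≤ β * Real.log T := by positivity
  linarith

end SandwichedLower

/-! ### Weighted sums of divergences -/

section WeightedSums

lemma ereal_coe_sum {ι : Type*} (s : Finset ι) (f : ι → ℝ) :
    ((∑ i ∈ s, f i : ℝ) : EReal) = ∑ i ∈ s, (f i : EReal) :=
  map_sum (⟨⟨Real.toEReal, EReal.coe_zero⟩, EReal.coe_add⟩ : ℝ →+ EReal) f s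

lemma ereal_sum_eq_top {ι : Type*} {s : Finset ι} {f : ι → EReal} (hbot : ∀ i ∈ s, f i ≠ ⊥)
    {j : ι} (hj : j ∈ s) (hjt : f j = ⊤) : ∑ i ∈ s, f i = ⊤ := by
  classical
  rw [← Finset.add_sum_erase s f hj, hjt]
  refine EReal.top_add_of_ne_bot ?_
  have : ∀ t : Finset ι, (∀ i ∈ t, f i ≠ ⊥) → ∑ i ∈ t, f i ≠ ⊥ := by
    intro t
    induction t using Finset.induction_on with
    | empty => simp
    | insert a t ha ih =>
      intro h
      rw [Finset.sum_insert ha, EReal.add_ne_bot_iff]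
      exact ⟨h a (by simp), ih fun i hi => h i (by simp [hi])⟩
  exact this _ fun i hi => hbot i (Finset.mem_of_mem_erase hi)

variable {B : Type*} [Fintype B] [DecidableEq B]

/-- For every Hermitian `γ` of unit trace, the `s`-average of the extended sandwiched divergences
relative to `σ_x = W_x diag(r_x) W_x†` is at least `-ln Tr exp(∑ₓ sₓ L_x)`, for any
`L_x = W_x diag(ℓ_x) W_x†` dominating `ln σ_x` on the support of `σ_x`. -/
lemma neg_log_expTrace_le_sum_sandwiched [Nonempty B] {m : ℕ} {s : Fin m → ℝ}
    (hs : s ∈ stdSimplex ℝ (Fin m)) {W : Fin m → Matrix B B ℂ}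
    (hW : ∀ x, W x ∈ unitaryGroup B ℂ) {r ℓ : Fin m → B → ℝ} (hr : ∀ x k, 0 ≤ r x k)
    (hℓ : ∀ x k, 0 < r x k → Real.log (r x k) ≤ ℓ x k) {γ : Matrix B B ℂ} (hγ : γ ∈ affStates B)
    {α : ℝ} (hα : 1 < α) :
    ((-Real.log (expTrace (∑ x, s x • conjDiag (W x) (ℓ x))) : ℝ) : EReal)
      ≤ ∑ x, (s x : EReal) * sandwiched α γ (conjDiag (W x) (r x)) := by
  have hbot : ∀ x ∈ Finset.univ, (s x : EReal) * sandwiched α γ (conjDiag (W x) (r x)) ≠ ⊥ := by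
    intro x _
    unfold sandwiched
    split_ifs with h
    · rw [← EReal.coe_mul]; exact EReal.coe_ne_bot _
    · rcases (hs.1 x).eq_or_lt with h0 | h0
      · rw [← h0]; simp
      · rw [EReal.coe_mul_top_of_pos h0]; simp
  by_cases hall : ∀ x, 0 < s x → supp γ ≤ supp (conjDiag (W x) (r x))
  swap
  · push Not at hall
    obtain ⟨x, hx, hsx⟩ := hall
    rw [ereal_sum_eq_top hbot (Finset.mem_univ x)]
    · exact le_top
    · rw [sandwiched, if_neg hsx, EReal.coe_mul_top_of_pos hx]
  obtain ⟨E, hE, g, rfl⟩ := exists_eq_conjDiag hγ.1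
  have hg : ∑ i, g i = 1 := by
    have := hγ.2
    rw [trace_conjDiag hE] at this
    exact_mod_cast this
  set T := ∑ i, |g i| with hT
  have hT0 : 0 < T := by
    have : (1 : ℝ) ≤ T := by
      rw [← hg, hT]
      exact Finset.sum_le_sum fun i _ => le_abs_self _
    linarith
  set p : B → ℝ := fun i => |g i| / T with hp
  have hp0 : ∀ i, 0 ≤ p i := fun i => by simp only [hp]; positivity
  have hp1 : ∑ i, p i = 1 := by
    simp only [hp]; rw [← Finset.sum_div]; exact div_self hT0.ne'
  set P := ∑ i, p i * Real.log (p i) with hP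
  have hKh : (∑ x, s x • conjDiag (W x) (ℓ x)).IsHermitian := by
    simp only [smul_conjDiag]
    exact isSelfAdjoint_sum _ fun x _ => conjDiag_isHermitian _ _
  have hgibbs := neg_log_expTrace_le hE hp0 hp1 hKh
  have htr : (conjDiag E p * ∑ x, s x • conjDiag (W x) (ℓ x)).trace.re
      = ∑ x, s x * (conjDiag E p * conjDiag (W x) (ℓ x)).trace.re := by
    rw [Matrix.mul_sum, trace_sum, Complex.re_sum]
    refine Finset.sum_congr rfl fun x _ => ?_
    rw [Matrix.mul_smul, trace_smul, Complex.smul_re, smul_eq_mul]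
  have hterm : ∀ x, ((s x * (P - (conjDiag E p * conjDiag (W x) (ℓ x)).trace.re) : ℝ) : EReal)
      ≤ (s x : EReal) * sandwiched α (conjDiag E g) (conjDiag (W x) (r x)) := by
    intro x
    rcases (hs.1 x).eq_or_lt with h0 | h0
    · rw [← h0]; simp
    · have hsupp := hall x h0
      rw [sandwiched, if_pos hsupp, ← EReal.coe_mul, EReal.coe_le_coe_iff]
      refine mul_le_mul_of_nonneg_left (le_trans ?_ (relEntropy_abs_le_sandwiched (hW x) hE (hr x)
        hg hsupp hα (p := p) fun i => rfl)) h0.le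
      rw [trace_mul_comm, trace_conjDiag_mul, Complex.ofReal_re]
      refine sub_le_sub_left (Finset.sum_le_sum fun k _ => Finset.sum_le_sum fun i _ => ?_) _
      rcases (hr x k).eq_or_lt with hk | hk
      · have := overlap_mul_eq_zero (hW x) hE hsupp hk.symm i
        have h2 : overlap (W x) E k i * p i = 0 := by
          rcases mul_eq_zero.1 this with h | h
          · simp [h]
          · simp [hp, h]
        refine le_of_eq ?_
        rw [← mul_assoc, h2, zero_mul, mul_comm (ℓ x k), ← mul_assoc, h2, zero_mul]
      · refine mul_le_mul_of_nonneg_left ?_ (overlap_nonneg _ _ _ _)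
        rw [mul_comm]
        exact mul_le_mul_of_nonneg_right (hℓ x k hk) (hp0 i)
  calc _ ≤ ((∑ x, s x * (P - (conjDiag E p * conjDiag (W x) (ℓ x)).trace.re) : ℝ) : EReal) := by
        rw [EReal.coe_le_coe_iff]
        refine hgibbs.trans (le_of_eq ?_)
        simp_rw [mul_sub, Finset.sum_sub_distrib]
        rw [← Finset.sum_mul, hs.2, one_mul, htr]
    _ ≤ _ := by
        rw [ereal_coe_sum]
        exact Finset.sum_le_sum fun x _ => hterm x

end WeightedSums

/-! ### The limit in the log-Euclidean Chernoff divergence -/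

section LogEuclidean

variable {A : Type*} [Fintype A]

lemma nonempty_of_states {ρ : Matrix A A ℂ} (hρ : ρ ∈ states A) : Nonempty A := by
  by_contra h
  rw [not_nonempty_iff] at h
  have := hρ.2
  simp [trace] at this

variable [DecidableEq A] {r : ℕ}

/-- The exponent `∑ₓ sₓ ln(ρₓ + ε I)` in the log-Euclidean divergence. -/
noncomputable def logMean (s : Fin r → ℝ) (ρ : Fin r → Matrix A A ℂ) (ε : ℝ) : Matrix A A ℂ :=
  ∑ x, s x • cfc Real.log (ρ x + ε • (1 : Matrix A A ℂ))

lemma logEuclidean_eq (s : Fin r → ℝ) (ρ : Fin r → Matrix A A ℂ) (ε : ℝ) :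
    logEuclidean s ρ ε = -Real.log (expTrace (logMean s ρ ε)) := rfl

lemma cfc_log_conjDiag_add {V : Matrix A A ℂ} (hV : V ∈ unitaryGroup A ℂ) (d : A → ℝ) (ε : ℝ) :
    cfc Real.log (conjDiag V d + ε • (1 : Matrix A A ℂ))
      = conjDiag V (fun k => Real.log (d k + ε)) := by
  rw [← conjDiag_const hV, conjDiag_add, cfc_conjDiag hV]

lemma cfc_isHermitian (f : ℝ → ℝ) (H : Matrix A A ℂ) : (cfc f H).IsHermitian :=
  cfc_predicate f H

lemma logMean_isHermitian (s : Fin r → ℝ) (ρ : Fin r → Matrix A A ℂ) (ε : ℝ) :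
    (logMean s ρ ε).IsHermitian :=
  isSelfAdjoint_sum _ fun _ _ => IsSelfAdjoint.smul (IsSelfAdjoint.all _) (cfc_isHermitian _ _)

lemma trace_mul_log_add_mono {τ σ : Matrix A A ℂ} (hτ : τ.PosSemidef) (hσ : σ.PosSemidef)
    {ε ε' : ℝ} (hε : 0 < ε) (hεε' : ε ≤ ε') :
    (τ * cfc Real.log (σ + ε • (1 : Matrix A A ℂ))).trace.re
      ≤ (τ * cfc Real.log (σ + ε' • (1 : Matrix A A ℂ))).trace.re := by
  obtain ⟨U, hU, p, hp, rfl⟩ := exists_eq_conjDiag_of_posSemidef hτ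
  obtain ⟨V, hV, d, hd, rfl⟩ := exists_eq_conjDiag_of_posSemidef hσ
  rw [cfc_log_conjDiag_add hV, cfc_log_conjDiag_add hV, trace_conjDiag_mul, trace_conjDiag_mul,
    Complex.ofReal_re, Complex.ofReal_re]
  refine Finset.sum_le_sum fun i _ => Finset.sum_le_sum fun k _ =>
    mul_le_mul_of_nonneg_left (mul_le_mul_of_nonneg_left ?_ (hp i)) (overlap_nonneg U V i k)
  exact Real.log_le_log (by linarith [hd k]) (by linarith)

lemma logEuclidean_anti [Nonempty A] {s : Fin r → ℝ} (hs : ∀ x, 0 ≤ s x)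
    {ρ : Fin r → Matrix A A ℂ} (hρ : ∀ x, (ρ x).PosSemidef) {ε ε' : ℝ} (hε : 0 < ε)
    (hεε' : ε ≤ ε') : logEuclidean s ρ ε' ≤ logEuclidean s ρ ε := by
  rw [logEuclidean_eq, logEuclidean_eq, neg_le_neg_iff]
  have hH := logMean_isHermitian s ρ ε
  refine le_trans (le_add_of_nonneg_right ?_)
    (log_expTrace_add_le hH (logMean_isHermitian s ρ ε'))
  have hZ := expTrace_pos hH
  have hτ : ((expTrace (logMean s ρ ε))⁻¹ • cfc Real.exp (logMean s ρ ε)).PosSemidef := by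
    obtain ⟨U, hU, u, hHu⟩ := exists_eq_conjDiag hH
    nth_rewrite 2 [hHu]
    rw [cfc_conjDiag hU, smul_conjDiag]
    exact conjDiag_posSemidef U fun i => by positivity
  rw [Matrix.mul_sub, trace_sub, Complex.sub_re, sub_nonneg]
  generalize (expTrace (logMean s ρ ε))⁻¹ • cfc Real.exp (logMean s ρ ε) = τ at hτ
  simp only [logMean, Matrix.mul_sum, trace_sum, Complex.re_sum, Matrix.mul_smul, trace_smul,
    Complex.smul_re, smul_eq_mul]
  exact Finset.sum_le_sum fun x _ =>
    mul_le_mul_of_nonneg_left (trace_mul_log_add_mono hτ (hρ x) hε hεε') (hs x)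

lemma tendsto_logEuclidean [Nonempty A] {s : Fin r → ℝ} (hs : ∀ x, 0 ≤ s x)
    {ρ : Fin r → Matrix A A ℂ} (hρ : ∀ x, (ρ x).PosSemidef) :
    Filter.Tendsto (fun ε : ℝ => ((logEuclidean s ρ ε : ℝ) : EReal)) (𝓝[>] (0 : ℝ))
      (𝓝 (⨆ ε ∈ Set.Ioi (0 : ℝ), ((logEuclidean s ρ ε : ℝ) : EReal))) := by
  refine tendsto_order.2 ⟨fun a ha => ?_, fun a ha => ?_⟩
  · obtain ⟨ε, hε, ha⟩ := lt_biSup_iff.1 ha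
    filter_upwards [Ioc_mem_nhdsGT hε] with ε' hε'
    exact ha.trans_le (EReal.coe_le_coe_iff.2 (logEuclidean_anti hs hρ hε'.1 hε'.2))
  · filter_upwards [self_mem_nhdsWithin] with ε hε
    exact (le_biSup (fun ε : ℝ => ((logEuclidean s ρ ε : ℝ) : EReal)) hε).trans_lt ha

lemma chernoffFlat_eq [Nonempty A] {ρ : Fin r → Matrix A A ℂ} (hρ : ∀ x, (ρ x).PosSemidef) :
    chernoffFlat ρ = ⨆ s ∈ stdSimplex ℝ (Fin r), ⨆ ε ∈ Set.Ioi (0 : ℝ),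
      ((logEuclidean s ρ ε : ℝ) : EReal) :=
  biSup_congr fun _ hs => (tendsto_logEuclidean hs.1 hρ).limUnder_eq

end LogEuclidean

/-! ### Tensor powers -/

section TensorPowers

variable {A : Type*} {n : ℕ}

/-- The additive lift `∑ₘ 1 ⊗ ⋯ ⊗ L ⊗ ⋯ ⊗ 1` of `L` to `n` copies, with `L` in position `m`. -/
noncomputable def tensorSum [DecidableEq A] (n : ℕ) (L : Matrix A A ℂ) :
    Matrix (Fin n → A) (Fin n → A) ℂ :=
  of fun i j => ∑ m, L (i m) (j m) * ∏ k ∈ Finset.univ.erase m, (1 : Matrix A A ℂ) (i k) (j k)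

lemma tensorSum_sum_smul [DecidableEq A] {r : ℕ} (s : Fin r → ℝ) (L : Fin r → Matrix A A ℂ) :
    tensorSum n (∑ x, s x • L x) = ∑ x, s x • tensorSum n (L x) := by
  ext i j
  simp only [tensorSum, of_apply, Matrix.sum_apply, Matrix.smul_apply, Finset.sum_mul,
    Finset.smul_sum, smul_mul_assoc]
  exact Finset.sum_comm

variable [Fintype A]

lemma mul_of_prod (f g : Fin n → Matrix A A ℂ) :
    (of fun i j : Fin n → A => ∏ k, f k (i k) (j k)) * (of fun i j => ∏ k, g k (i k) (j k))
      = of fun i j => ∏ k, (f k * g k) (i k) (j k) := by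
  ext i j
  simp only [mul_apply, of_apply, ← Finset.prod_mul_distrib]
  rw [Finset.prod_univ_sum, Fintype.piFinset_univ]

lemma tensorPow_mul (M N : Matrix A A ℂ) :
    tensorPow n M * tensorPow n N = tensorPow n (M * N) :=
  mul_of_prod (fun _ => M) (fun _ => N)

lemma trace_tensorPow (M : Matrix A A ℂ) : (tensorPow n M).trace = M.trace ^ n := by
  rw [trace, trace, Fintype.sum_pow]
  rfl

omit [Fintype A] in
lemma tensorPow_conjTranspose (M : Matrix A A ℂ) : (tensorPow n M)ᴴ = tensorPow n Mᴴ := by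
  ext i j
  simp only [tensorPow, conjTranspose_apply, of_apply, star_prod]

omit [Fintype A] in
lemma tensorPow_diagonal [DecidableEq A] (d : A → ℂ) :
    tensorPow n (diagonal d) = diagonal fun i => ∏ k, d (i k) := by
  ext i j
  simp only [tensorPow, of_apply]
  by_cases h : i = j
  · subst h; simp
  · rw [diagonal_apply_ne _ h]
    obtain ⟨k, hk⟩ := Function.ne_iff.1 h
    exact Finset.prod_eq_zero (Finset.mem_univ k) (diagonal_apply_ne _ hk)

variable [DecidableEq A]

omit [Fintype A] in
lemma tensorPow_one : tensorPow n (1 : Matrix A A ℂ) = 1 := by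
  rw [← diagonal_one, tensorPow_diagonal]; simp

lemma tensorPow_mem_unitaryGroup {V : Matrix A A ℂ} (hV : V ∈ unitaryGroup A ℂ) :
    tensorPow n V ∈ unitaryGroup (Fin n → A) ℂ := by
  rw [mem_unitaryGroup_iff, star_eq_conjTranspose, tensorPow_conjTranspose, tensorPow_mul,
    mul_conjTranspose_self_of_unitary hV, tensorPow_one]

lemma tensorPow_conjDiag (V : Matrix A A ℂ) (d : A → ℝ) :
    tensorPow n (conjDiag V d) = conjDiag (tensorPow n V) fun i => ∏ k, d (i k) := by
  unfold conjDiag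
  rw [← tensorPow_mul, ← tensorPow_mul, tensorPow_diagonal, tensorPow_conjTranspose]
  push_cast; rfl

omit [Fintype A] in
lemma tensorSum_eq (L : Matrix A A ℂ) :
    tensorSum n L = ∑ m, of fun i j : Fin n → A =>
      ∏ k, (Function.update (fun _ => (1 : Matrix A A ℂ)) m L) k (i k) (j k) := by
  ext i j
  rw [tensorSum, of_apply, Matrix.sum_apply]
  refine Finset.sum_congr rfl fun m _ => ?_
  rw [of_apply, ← Finset.mul_prod_erase Finset.univ _ (Finset.mem_univ m), Function.update_self]
  congr 1
  refine Finset.prod_congr rfl fun k hk => ?_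
  rw [Function.update_of_ne (Finset.ne_of_mem_erase hk)]

lemma tensorSum_conj {V : Matrix A A ℂ} (hV : V ∈ unitaryGroup A ℂ) (L : Matrix A A ℂ) :
    tensorSum n (V * L * Vᴴ) = tensorPow n V * tensorSum n L * (tensorPow n V)ᴴ := by
  rw [tensorSum_eq, tensorSum_eq, Matrix.mul_sum, Matrix.sum_mul]
  refine Finset.sum_congr rfl fun m _ => ?_
  rw [tensorPow_conjTranspose, tensorPow, tensorPow, mul_of_prod (fun _ => V),
    mul_of_prod _ (fun _ => Vᴴ)]
  congr 1
  funext i j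
  refine Finset.prod_congr rfl fun k _ => ?_
  by_cases hk : k = m
  · subst hk; rw [Function.update_self, Function.update_self]
  · rw [Function.update_of_ne hk, Function.update_of_ne hk, Matrix.mul_one,
      mul_conjTranspose_self_of_unitary hV]

omit [Fintype A] in
lemma tensorSum_diagonal (d : A → ℂ) :
    tensorSum n (diagonal d) = diagonal fun i => ∑ k, d (i k) := by
  ext i j
  simp only [tensorSum, of_apply]
  by_cases h : i = j
  · subst h; simp
  · rw [diagonal_apply_ne _ h]
    refine Finset.sum_eq_zero fun m _ => ?_
    obtain ⟨k, hk⟩ := Function.ne_iff.1 h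
    by_cases hm : k = m
    · subst hm; rw [diagonal_apply_ne _ hk, zero_mul]
    · rw [Finset.prod_eq_zero (f := fun k => (1 : Matrix A A ℂ) (i k) (j k))
        (Finset.mem_erase.2 ⟨hm, Finset.mem_univ k⟩) (one_apply_ne hk), mul_zero]

lemma tensorSum_conjDiag {V : Matrix A A ℂ} (hV : V ∈ unitaryGroup A ℂ) (d : A → ℝ) :
    tensorSum n (conjDiag V d) = conjDiag (tensorPow n V) fun i => ∑ k, d (i k) := by
  unfold conjDiag
  rw [tensorSum_conj hV, tensorSum_diagonal]
  push_cast; rfl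

lemma expTrace_tensorSum {H : Matrix A A ℂ} (hH : H.IsHermitian) :
    expTrace (tensorSum n H) = expTrace H ^ n := by
  obtain ⟨V, hV, d, rfl⟩ := exists_eq_conjDiag hH
  rw [tensorSum_conjDiag hV, expTrace_conjDiag (tensorPow_mem_unitaryGroup hV),
    expTrace_conjDiag hV, Fintype.sum_pow]
  exact Finset.sum_congr rfl fun i _ => Real.exp_sum _ _

end TensorPowers

/-! ### The lower bounds -/

section LowerBounds

variable {A : Type*} [Fintype A] [DecidableEq A] {r : ℕ}

lemma logEuclidean_le_sum_sandwiched [Nonempty A] {s : Fin r → ℝ}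
    (hs : s ∈ stdSimplex ℝ (Fin r)) {ρ : Fin r → Matrix A A ℂ} (hρ : ∀ x, (ρ x).PosSemidef)
    {ε : ℝ} (hε : 0 < ε) {α : ℝ} (hα : 1 < α) {γ : Matrix A A ℂ} (hγ : γ ∈ affStates A) :
    ((logEuclidean s ρ ε : ℝ) : EReal) ≤ ∑ x, (s x : EReal) * sandwiched α γ (ρ x) := by
  choose V hV d hd hx using fun x => exists_eq_conjDiag_of_posSemidef (hρ x)
  have h := neg_log_expTrace_le_sum_sandwiched hs hV hd
    (ℓ := fun x k => Real.log (d x k + ε))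
    (fun x k hk => Real.log_le_log hk (by linarith)) hγ hα
  simp only [← hx] at h
  rw [logEuclidean_eq, logMean]
  refine le_trans (le_of_eq ?_) h
  congr 5
  funext x
  rw [hx, cfc_log_conjDiag_add (hV x)]

lemma logEuclidean_le_sum_sandwiched_tensorPow [Nonempty A] {s : Fin r → ℝ}
    (hs : s ∈ stdSimplex ℝ (Fin r)) {ρ : Fin r → Matrix A A ℂ} (hρ : ∀ x, (ρ x).PosSemidef)
    {ε : ℝ} (hε : 0 < ε) {α : ℝ} (hα : 1 < α) {n : ℕ} (hn : 0 < n)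
    {γ : Matrix (Fin n → A) (Fin n → A) ℂ} (hγ : γ ∈ affStates (Fin n → A)) :
    ((logEuclidean s ρ ε : ℝ) : EReal) ≤
      ((1 / (n : ℝ) : ℝ) : EReal) *
        ∑ x, (s x : EReal) * sandwiched α γ (tensorPow n (ρ x)) := by
  choose V hV d hd hx using fun x => exists_eq_conjDiag_of_posSemidef (hρ x)
  have h := neg_log_expTrace_le_sum_sandwiched hs
    (fun x => tensorPow_mem_unitaryGroup (n := n) (hV x))
    (r := fun x i => ∏ k, d x (i k)) (fun x i => Finset.prod_nonneg fun k _ => hd x _)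
    (ℓ := fun x i => ∑ k, Real.log (d x (i k) + ε))
    (fun x i hi => by
      have hpos : ∀ k, d x (i k) ≠ 0 := fun k hk =>
        hi.ne' (Finset.prod_eq_zero (Finset.mem_univ k) hk)
      rw [Real.log_prod (fun k _ => hpos k)]
      exact Finset.sum_le_sum fun k _ =>
        Real.log_le_log (lt_of_le_of_ne (hd x _) (hpos k).symm) (by linarith)) hγ hα
  have e1 : ∀ x, conjDiag (tensorPow n (V x)) (fun i => ∏ k, d x (i k)) = tensorPow n (ρ x) := by
    intro x; rw [hx x, tensorPow_conjDiag]
  have e2 : ∑ x, s x • conjDiag (tensorPow n (V x)) (fun i => ∑ k, Real.log (d x (i k) + ε))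
      = tensorSum n (logMean s ρ ε) := by
    rw [logMean, tensorSum_sum_smul]
    refine Finset.sum_congr rfl fun x _ => ?_
    rw [hx x, cfc_log_conjDiag_add (hV x), tensorSum_conjDiag (hV x)]
  simp only [e1] at h
  rw [e2, expTrace_tensorSum (logMean_isHermitian s ρ ε), Real.log_pow] at h
  have hn' : (0 : ℝ) < n := by exact_mod_cast hn
  have h2 := mul_le_mul_of_nonneg_left h
    (EReal.coe_nonneg.2 (by positivity : (0 : ℝ) ≤ 1 / (n : ℝ)))
  refine le_trans (le_of_eq ?_) h2
  rw [← EReal.coe_mul, logEuclidean_eq]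
  congr 1
  field_simp

lemma chernoffFlat_le_regularised [Nonempty A] {ρ : Fin r → Matrix A A ℂ}
    (hρ : ∀ x, (ρ x).PosSemidef) {α : ℝ} (hα : 1 < α) {n : ℕ} (hn : 0 < n) :
    chernoffFlat ρ ≤ ⨆ s ∈ stdSimplex ℝ (Fin r), ⨅ τ ∈ affStates (Fin n → A),
      ((1 / (n : ℝ) : ℝ) : EReal) * ∑ x, ((s x : ℝ) : EReal) *
        sandwiched α τ (tensorPow n (ρ x)) := by
  rw [chernoffFlat_eq hρ]
  exact iSup₂_mono fun s hs => iSup₂_le fun ε hε => le_iInf₂ fun γ hγ =>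
    logEuclidean_le_sum_sandwiched_tensorPow hs hρ hε hα hn hγ

lemma chernoffFlat_le_oneShot [Nonempty A] {ρ : Fin r → Matrix A A ℂ}
    (hρ : ∀ x, (ρ x).PosSemidef) {α : ℝ} (hα : 1 < α) :
    chernoffFlat ρ ≤ ⨆ s ∈ stdSimplex ℝ (Fin r), ⨅ τ ∈ affStates A,
      ∑ x, ((s x : ℝ) : EReal) * sandwiched α τ (ρ x) := by
  rw [chernoffFlat_eq hρ]
  exact iSup₂_mono fun s hs => iSup₂_le fun ε hε => le_iInf₂ fun γ hγ =>
    logEuclidean_le_sum_sandwiched hs hρ hε hα hγ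

end LowerBounds

/-! ### A state that is optimal against all hypotheses -/

section Minimax

lemma sum_smul_isHermitian {A : Type*} {r : ℕ} {L : Fin r → Matrix A A ℂ}
    (hL : ∀ x, (L x).IsHermitian) (s : Fin r → ℝ) : (∑ x, s x • L x).IsHermitian :=
  isSelfAdjoint_sum _ fun x _ => IsSelfAdjoint.smul (IsSelfAdjoint.all _) (hL x)

variable {A : Type*} [Fintype A]

lemma isClosed_states : IsClosed (states A) := by
  have h1 : IsClosed {ρ : Matrix A A ℂ | ρ.IsHermitian} :=
    isClosed_eq (by fun_prop) continuous_id
  have h2 : IsClosed {ρ : Matrix A A ℂ | ∀ v : A → ℂ, 0 ≤ star v ⬝ᵥ ρ *ᵥ v} := by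
    simp only [Set.ofPred_forall]
    exact isClosed_iInter fun v => isClosed_le continuous_const (by fun_prop)
  have h3 : IsClosed {ρ : Matrix A A ℂ | ρ.trace = 1} :=
    isClosed_eq (by fun_prop) continuous_const
  have : states A = ({ρ : Matrix A A ℂ | ρ.IsHermitian} ∩
      {ρ : Matrix A A ℂ | ∀ v : A → ℂ, 0 ≤ star v ⬝ᵥ ρ *ᵥ v}) ∩ {ρ | ρ.trace = 1} := by
    ext ρ
    simp [states, posSemidef_iff_dotProduct_mulVec]
  rw [this]
  exact (h1.inter h2).inter h3

variable [DecidableEq A] {r : ℕ}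

lemma cfc_exp_eq {H : Matrix A A ℂ} (hH : H.IsHermitian) : cfc Real.exp H = NormedSpace.exp H := by
  obtain ⟨V, hV, d, rfl⟩ := exists_eq_conjDiag hH
  rw [cfc_conjDiag hV]
  have hinv : V⁻¹ = Vᴴ := inv_eq_right_inv (mul_conjTranspose_self_of_unitary hV)
  have hu : IsUnit V :=
    IsUnit.of_mul_eq_one _ (mul_conjTranspose_self_of_unitary hV)
  unfold conjDiag
  rw [← hinv, Matrix.exp_conj _ _ hu, Matrix.exp_diagonal]
  congr 3
  funext i
  rw [Pi.coe_exp, ← Complex.exp_eq_exp_ℂ, Complex.ofReal_exp]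

open scoped Matrix.Norms.Operator in
lemma continuous_matrix_exp :
    Continuous (NormedSpace.exp : Matrix A A ℂ → Matrix A A ℂ) :=
  NormedSpace.exp_continuous

lemma continuous_cfc_exp_sum_smul {L : Fin r → Matrix A A ℂ} (hL : ∀ x, (L x).IsHermitian) :
    Continuous fun s : Fin r → ℝ => cfc Real.exp (∑ x, s x • L x) := by
  simp_rw [fun s => cfc_exp_eq (sum_smul_isHermitian hL s)]
  exact continuous_matrix_exp.comp (by fun_prop)

/-- Minimax principle for Gibbs states: if the free energies `-ln Tr exp(∑ₓ sₓ Lₓ)` are bounded by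
`C` over the whole simplex, then the Gibbs state at a maximiser `s` has relative entropy at most
`C` with respect to every `e^{Lₓ}`. The entropy of the state is written in dual form, as a
supremum over `K`, to make the condition closed in the state. -/
lemma exists_state_forall_le [Nonempty A] (hr : 1 ≤ r) {L : Fin r → Matrix A A ℂ}
    (hL : ∀ x, (L x).IsHermitian) {C : ℝ}
    (hC : ∀ s ∈ stdSimplex ℝ (Fin r), -Real.log (expTrace (∑ x, s x • L x)) ≤ C) :
    ∃ τ ∈ states A, ∀ x, ∀ K : Matrix A A ℂ, K.IsHermitian →
      (τ * (K - L x)).trace.re - Real.log (expTrace K) ≤ C := by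
  set H : (Fin r → ℝ) → Matrix A A ℂ := fun s => ∑ x, s x • L x with hHdef
  have hH : ∀ s, (H s).IsHermitian := fun s => sum_smul_isHermitian hL s
  have hHc : Continuous H := by rw [hHdef]; fun_prop
  have hZ : ∀ s, 0 < expTrace (H s) := fun s => expTrace_pos (hH s)
  have hEc : Continuous fun s => cfc Real.exp (H s) := continuous_cfc_exp_sum_smul hL
  have hZc : Continuous fun s => expTrace (H s) :=
    Complex.continuous_re.comp hEc.matrix_trace
  have hFc : Continuous fun s => -Real.log (expTrace (H s)) :=
    (hZc.log fun s => (hZ s).ne').neg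
  obtain ⟨s₀, hs₀, hmax⟩ := (isCompact_stdSimplex ℝ (Fin r)).exists_isMaxOn
    ⟨_, single_mem_stdSimplex ℝ (⟨0, hr⟩ : Fin r)⟩ hFc.continuousOn
  set τ : (Fin r → ℝ) → Matrix A A ℂ := fun s => (expTrace (H s))⁻¹ • cfc Real.exp (H s) with hτ
  have hτc : Continuous τ := (hZc.inv₀ fun s => (hZ s).ne').smul hEc
  refine ⟨τ s₀, ?_, fun x K hK => ?_⟩
  · obtain ⟨V, hV, h, hVh⟩ := exists_eq_conjDiag (hH s₀)
    have hZs : ∑ j, Real.exp (h j) = expTrace (H s₀) := by rw [hVh, expTrace_conjDiag hV]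
    have hτ₀ : τ s₀ = conjDiag V fun i => (expTrace (H s₀))⁻¹ * Real.exp (h i) := by
      simp only [hτ]
      nth_rewrite 2 [hVh]
      rw [cfc_conjDiag hV, smul_conjDiag]
    rw [hτ₀]
    refine ⟨conjDiag_posSemidef V fun i => ?_, ?_⟩
    · have := hZ s₀
      positivity
    · rw [trace_conjDiag hV, ← Finset.mul_sum, hZs, inv_mul_cancel₀ (hZ s₀).ne', Complex.ofReal_one]
  · -- move from `s₀` towards the vertex `x`; the first-order condition survives in the limit
    have hvar : (τ s₀ * (H s₀ - L x)).trace.re ≤ 0 := by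
      set c : ℝ → Fin r → ℝ := fun t => (1 - t) • s₀ + t • Pi.single x 1 with hc
      have hcc : Continuous c := by rw [hc]; fun_prop
      have hlim : Filter.Tendsto (fun t => (τ (c t) * (H s₀ - L x)).trace.re) (𝓝[>] (0 : ℝ))
          (𝓝 (τ (c 0) * (H s₀ - L x)).trace.re) := by
        have : Continuous fun t => (τ (c t) * (H s₀ - L x)).trace.re :=
          Complex.continuous_re.comp
            (((hτc.comp hcc).matrix_mul continuous_const).matrix_trace)
        exact (this.tendsto 0).mono_left nhdsWithin_le_nhds
      have hc0 : c 0 = s₀ := by simp [hc]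
      rw [hc0] at hlim
      refine le_of_tendsto hlim ?_
      filter_upwards [Ioc_mem_nhdsGT one_pos] with t ht
      have hct : c t ∈ stdSimplex ℝ (Fin r) :=
        convex_stdSimplex ℝ (Fin r) hs₀ (single_mem_stdSimplex ℝ x) (by linarith [ht.2]) ht.1.le
          (by ring)
      have h1 : -Real.log (expTrace (H (c t))) ≤ -Real.log (expTrace (H s₀)) := hmax hct
      have h2 := log_expTrace_add_le (hH (c t)) (hH s₀)
      have hHct : H s₀ - H (c t) = t • (H s₀ - L x) := by
        have : H (c t) = (1 - t) • H s₀ + t • L x := by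
          simp only [hHdef, hc, Pi.add_apply, Pi.smul_apply, smul_eq_mul, add_smul,
            Finset.sum_add_distrib, mul_smul, Finset.smul_sum]
          congr 1
          rw [Finset.sum_eq_single x]
          · simp
          · intro y _ hy; simp [Pi.single_eq_of_ne hy]
          · simp
        rw [this, sub_smul, one_smul, smul_sub]
        abel
      rw [hHct, Matrix.mul_smul, trace_smul, Complex.smul_re, smul_eq_mul] at h2
      have h3 : t * (τ (c t) * (H s₀ - L x)).trace.re ≤ 0 := by
        simp only [hτ]; linarith
      exact nonpos_of_mul_nonpos_right h3 ht.1
    have h1 := log_expTrace_add_le (hH s₀) hK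
    have h2 : (τ s₀ * (K - L x)).trace.re
        = (τ s₀ * (K - H s₀)).trace.re + (τ s₀ * (H s₀ - L x)).trace.re := by
      rw [← Complex.add_re, ← trace_add, ← Matrix.mul_add, sub_add_sub_cancel]
    have h3 := hC s₀ hs₀
    have h4 : (τ s₀ * (K - H s₀)).trace.re
      = ((expTrace (H s₀))⁻¹ • cfc Real.exp (H s₀) * (K - H s₀)).trace.re := rfl
    rw [h2, h4]
    simp only [hHdef] at h1 h3 ⊢
    linarith

lemma norm_apply_le_one_of_mem_states {ρ : Matrix A A ℂ} (hρ : ρ ∈ states A) (i j : A) :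
    ‖ρ i j‖ ≤ 1 := by
  obtain ⟨V, hV, p, hp, rfl⟩ := exists_eq_conjDiag_of_posSemidef hρ.1
  have hp1 : ∑ k, p k = 1 := by
    have := hρ.2
    rw [trace_conjDiag hV] at this
    exact_mod_cast this
  rw [conjDiag, mul_apply, ← hp1]
  refine (norm_sum_le _ _).trans (Finset.sum_le_sum fun k _ => ?_)
  rw [mul_diagonal, conjTranspose_apply, norm_mul, norm_mul, norm_star, Complex.norm_real,
    Real.norm_of_nonneg (hp k)]
  have h1 := entry_norm_bound_of_unitary hV i k
  have h2 := entry_norm_bound_of_unitary hV j k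
  calc ‖V i k‖ * p k * ‖V j k‖ ≤ 1 * p k * 1 := by
        have := hp k
        gcongr
    _ = p k := by ring

lemma isCompact_states : IsCompact (states A) := by
  refine IsCompact.of_isClosed_subset (isCompact_univ_pi (X := fun _ : A => A → ℂ)
    fun i => isCompact_univ_pi fun j => isCompact_closedBall (0 : ℂ) 1) isClosed_states ?_
  intro ρ hρ i _ j _
  simpa using norm_apply_le_one_of_mem_states hρ i j

/-- A compactness argument removes the regularisation `ε` from `exists_state_forall_le`: one state
works along the whole sequence `ε = 1 / (n + 1)`. -/
lemma exists_state_forall_regularised_le [Nonempty A] (hr : 1 ≤ r) {ρ : Fin r → Matrix A A ℂ}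
    (hρ : ∀ x, (ρ x).PosSemidef) {C : ℝ}
    (hC : ∀ s ∈ stdSimplex ℝ (Fin r), ∀ ε > 0, logEuclidean s ρ ε ≤ C) :
    ∃ τ ∈ states A, ∀ n : ℕ, ∀ x, ∀ K : Matrix A A ℂ, K.IsHermitian →
      (τ * (K - cfc Real.log (ρ x + (1 / ((n : ℝ) + 1)) • (1 : Matrix A A ℂ)))).trace.re
        - Real.log (expTrace K) ≤ C := by
  set t : ℕ → Set (Matrix A A ℂ) := fun n => {τ ∈ states A | ∀ x, ∀ K : Matrix A A ℂ,
    K.IsHermitian →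
      (τ * (K - cfc Real.log (ρ x + (1 / ((n : ℝ) + 1)) • (1 : Matrix A A ℂ)))).trace.re
        - Real.log (expTrace K) ≤ C} with ht
  have hcl : ∀ n, IsClosed (t n) := by
    intro n
    have : t n = states A ∩ ⋂ (x : Fin r) (K : Matrix A A ℂ) (_ : K.IsHermitian),
        {τ | (τ * (K - cfc Real.log (ρ x + (1 / ((n : ℝ) + 1)) • (1 : Matrix A A ℂ)))).trace.re
          - Real.log (expTrace K) ≤ C} := by
      ext τ; simp [ht]
    rw [this]
    refine isClosed_states.inter (isClosed_iInter fun x => isClosed_iInter fun K =>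
      isClosed_iInter fun _ => isClosed_le ?_ continuous_const)
    exact (Complex.continuous_re.comp
      ((continuous_id.matrix_mul continuous_const).matrix_trace)).sub continuous_const
  have hne : ∀ n, (t n).Nonempty := by
    intro n
    obtain ⟨τ, hτ, h⟩ := exists_state_forall_le hr
      (L := fun x => cfc Real.log (ρ x + (1 / ((n : ℝ) + 1)) • (1 : Matrix A A ℂ)))
      (fun x => cfc_isHermitian _ _) (fun s hs => hC s hs (1 / ((n : ℝ) + 1)) (by positivity))
    exact ⟨τ, hτ, h⟩
  have hmono : ∀ n, t (n + 1) ⊆ t n := by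
    rintro n τ ⟨hτ, h⟩
    refine ⟨hτ, fun x K hK => (le_trans ?_ (h x K hK))⟩
    have hle : 1 / (((n + 1 : ℕ) : ℝ) + 1) ≤ 1 / ((n : ℝ) + 1) := by
      push_cast
      exact one_div_le_one_div_of_le (by positivity) (by linarith)
    have := trace_mul_log_add_mono hτ.1 (hρ x)
      (by positivity : (0 : ℝ) < 1 / (((n + 1 : ℕ) : ℝ) + 1)) hle
    simp only [Matrix.mul_sub, trace_sub, Complex.sub_re]
    linarith
  obtain ⟨τ, hτ⟩ := IsCompact.nonempty_iInter_of_sequence_nonempty_isCompact_isClosed t hmono hne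
    (isCompact_states.of_isClosed_subset (hcl 0) fun τ hτ => hτ.1) hcl
  rw [Set.mem_iInter] at hτ
  exact ⟨τ, (hτ 0).1, fun n => (hτ n).2⟩

end Minimax

/-! ### Relative entropy of the optimal state -/

section RelativeEntropy

variable {A : Type*} [Fintype A] [DecidableEq A]

lemma supp_le_of_overlap {W E : Matrix A A ℂ} (hW : W ∈ unitaryGroup A ℂ) {r g : A → ℝ}
    (h : ∀ k, r k = 0 → ∀ i, overlap W E k i * g i = 0) :
    supp (conjDiag E g) ≤ supp (conjDiag W r) := by
  rw [supp_le_iff]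
  refine ⟨conjDiag W (fun k => (r k)⁻¹) * conjDiag E g, ?_⟩
  have h1 : diagonal (fun k => ((r k * (r k)⁻¹ : ℝ) : ℂ)) * ((Wᴴ * E) * diagonal fun i => (g i : ℂ))
      = (Wᴴ * E) * diagonal fun i => (g i : ℂ) := by
    ext k i
    rw [diagonal_mul, mul_diagonal]
    by_cases hk : r k = 0
    · rcases mul_eq_zero.1 (h k hk i) with h0 | h0
      · have : (Wᴴ * E) k i = 0 := by simpa [overlap] using h0
        rw [this]; simp
      · rw [h0]; simp
    · rw [mul_inv_cancel₀ hk]; simp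
  have hWW := mul_conjTranspose_self_of_unitary hW
  rw [← Matrix.mul_assoc, conjDiag_mul hW]
  unfold conjDiag
  calc E * diagonal (fun i => (g i : ℂ)) * Eᴴ
      = W * ((Wᴴ * E) * diagonal fun i => (g i : ℂ)) * Eᴴ := by
        rw [← Matrix.mul_assoc, ← Matrix.mul_assoc, hWW, Matrix.one_mul]
    _ = _ := by
        rw [← h1]
        simp only [Matrix.mul_assoc]

/-- The limit `ε → 0` of the dual bounds: the state is supported on the support of `ρ` and its
Umegaki relative entropy is at most `C`. -/
lemma supp_le_and_relEntropy_le {E W : Matrix A A ℂ} (hE : E ∈ unitaryGroup A ℂ)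
    (hW : W ∈ unitaryGroup A ℂ) {p r : A → ℝ} (hp : ∀ i, 0 ≤ p i) (hp1 : ∑ i, p i = 1)
    (hr : ∀ k, 0 ≤ r k) (hr1 : ∀ k, r k ≤ 1) {C : ℝ}
    (h : ∀ n : ℕ, ∀ K : Matrix A A ℂ, K.IsHermitian →
      (conjDiag E p * (K - cfc Real.log (conjDiag W r
        + (1 / ((n : ℝ) + 1)) • (1 : Matrix A A ℂ)))).trace.re - Real.log (expTrace K) ≤ C) :
    supp (conjDiag E p) ≤ supp (conjDiag W r) ∧
      ∑ i, p i * Real.log (p i) - ∑ k, ∑ i, overlap W E k i * (p i * Real.log (r k)) ≤ C := by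
  set P := ∑ i, p i * Real.log (p i) with hP
  set q : A → ℝ := fun k => ∑ i, overlap W E k i * p i with hq
  have hq0 : ∀ k, 0 ≤ q k := fun k =>
    Finset.sum_nonneg fun i _ => mul_nonneg (overlap_nonneg _ _ _ _) (hp i)
  have hq1 : ∑ k, q k = 1 := by
    rw [← hp1]; exact sum_overlap_mul_right hW hE p
  -- insert `K = ln (τ + η)` into the dual bound and let `η → 0`
  have hbound : ∀ n : ℕ, P - ∑ k, q k * Real.log (r k + 1 / ((n : ℝ) + 1)) ≤ C := by
    intro n
    set ε : ℝ := 1 / ((n : ℝ) + 1) with hε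
    have hη : ∀ η : ℝ, 0 < η → P - ∑ k, q k * Real.log (r k + ε) ≤ C + Fintype.card A * η := by
      intro η hη
      have h1 := h n (conjDiag E fun i => Real.log (p i + η)) (conjDiag_isHermitian _ _)
      rw [expTrace_conjDiag hE, Matrix.mul_sub, trace_sub, Complex.sub_re, conjDiag_mul hE,
        trace_conjDiag hE, Complex.ofReal_re, cfc_log_conjDiag_add hW, trace_mul_comm,
        trace_conjDiag_mul, Complex.ofReal_re] at h1
      have e1 : ∑ i, Real.exp (Real.log (p i + η)) = 1 + Fintype.card A * η := by
        have : ∀ i, Real.exp (Real.log (p i + η)) = p i + η := fun i =>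
          Real.exp_log (by linarith [hp i])
        simp_rw [this, Finset.sum_add_distrib, hp1]
        simp [Finset.card_univ]
      have e2 : ∑ k, ∑ i, overlap W E k i * (Real.log (r k + 1 / ((n : ℝ) + 1)) * p i)
          = ∑ k, q k * Real.log (r k + ε) := by
        refine Finset.sum_congr rfl fun k _ => ?_
        simp only [hq, Finset.sum_mul]
        exact Finset.sum_congr rfl fun i _ => by ring
      have e3 : Real.log (1 + Fintype.card A * η) ≤ Fintype.card A * η := by
        have := Real.log_le_sub_one_of_pos (show (0 : ℝ) < 1 + Fintype.card A * η by positivity)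
        linarith
      have e4 : P ≤ ∑ i, p i * Real.log (p i + η) := by
        refine Finset.sum_le_sum fun i _ => ?_
        rcases (hp i).eq_or_lt with h0 | h0
        · rw [← h0]; simp
        · exact mul_le_mul_of_nonneg_left (Real.log_le_log h0 (by linarith)) h0.le
      rw [e1, e2] at h1
      linarith
    refine le_of_forall_pos_le_add fun δ hδ => ?_
    have hc : (0 : ℝ) < Fintype.card A + 1 := by positivity
    refine (hη (δ / (Fintype.card A + 1)) (by positivity)).trans ?_
    have : Fintype.card A * (δ / (Fintype.card A + 1)) ≤ δ := by
      rw [← mul_div_assoc, div_le_iff₀ hc]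
      nlinarith
    linarith
  have hεlim : Filter.Tendsto (fun n : ℕ => 1 / ((n : ℝ) + 1)) Filter.atTop (𝓝[>] 0) :=
    tendsto_nhdsWithin_iff.2 ⟨tendsto_one_div_add_atTop_nhds_zero_nat,
      Filter.Eventually.of_forall fun n => by
        have : (0 : ℝ) < 1 / ((n : ℝ) + 1) := by positivity
        exact this⟩
  -- a kernel vector of `ρ` with positive weight would contribute `-ln ε → ∞`
  have hker : ∀ k, r k = 0 → q k = 0 := by
    intro k hk
    by_contra hne
    have hqk : 0 < q k := lt_of_le_of_ne (hq0 k) (Ne.symm hne)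
    have hle : ∀ n : ℕ, (P - C - Real.log 2) / q k ≤ Real.log (1 / ((n : ℝ) + 1)) := by
      intro n
      have hε0 : (0 : ℝ) < 1 / ((n : ℝ) + 1) := by positivity
      have hε1 : 1 / ((n : ℝ) + 1) ≤ 1 := by
        rw [div_le_one (by positivity)]; linarith [(Nat.cast_nonneg n : (0 : ℝ) ≤ n)]
      have h1 := hbound n
      have hl2 : 0 ≤ Real.log 2 := Real.log_nonneg (by norm_num)
      have h2 : ∑ j, q j * Real.log (r j + 1 / ((n : ℝ) + 1))
          ≤ q k * Real.log (1 / ((n : ℝ) + 1)) + Real.log 2 := by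
        rw [← Finset.add_sum_erase _ _ (Finset.mem_univ k), hk, zero_add]
        gcongr
        calc ∑ j ∈ Finset.univ.erase k, q j * Real.log (r j + 1 / ((n : ℝ) + 1))
            ≤ ∑ j ∈ Finset.univ.erase k, q j * Real.log 2 :=
              Finset.sum_le_sum fun j _ => mul_le_mul_of_nonneg_left
                (Real.log_le_log (by linarith [hr j]) (by linarith [hr1 j])) (hq0 j)
          _ ≤ ∑ j, q j * Real.log 2 :=
              Finset.sum_le_sum_of_subset_of_nonneg (Finset.erase_subset _ _)
                fun j _ _ => mul_nonneg (hq0 j) hl2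
          _ = Real.log 2 := by rw [← Finset.sum_mul, hq1, one_mul]
      rw [div_le_iff₀ hqk]
      linarith
    have h3 := (Real.tendsto_log_nhdsGT_zero.comp hεlim).eventually
      (Filter.eventually_lt_atBot ((P - C - Real.log 2) / q k))
    obtain ⟨n, hn⟩ := h3.exists
    exact absurd hn (not_lt.2 (hle n))
  refine ⟨supp_le_of_overlap hW fun k hk i => ?_, ?_⟩
  · have := hker k hk
    exact (Finset.sum_eq_zero_iff_of_nonneg fun i _ =>
      mul_nonneg (overlap_nonneg W E k i) (hp i)).1 this i (Finset.mem_univ i)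
  · have hlim : Filter.Tendsto (fun n : ℕ => P - ∑ k, q k * Real.log (r k + 1 / ((n : ℝ) + 1)))
        Filter.atTop (𝓝 (P - ∑ k, q k * Real.log (r k))) := by
      refine tendsto_const_nhds.sub (tendsto_finsetSum _ fun k _ => ?_)
      by_cases hk : r k = 0
      · rw [hker k hk]; simp
      · refine tendsto_const_nhds.mul (Filter.Tendsto.log ?_ hk)
        simpa using tendsto_const_nhds.add (tendsto_one_div_add_atTop_nhds_zero_nat (𝕜 := ℝ))
    refine le_trans (le_of_eq ?_) (le_of_tendsto' hlim hbound)
    congr 1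
    refine Finset.sum_congr rfl fun k _ => ?_
    simp only [hq, Finset.sum_mul]
    exact Finset.sum_congr rfl fun i _ => by ring

end RelativeEntropy

/-! ### The sandwiched divergence of a state as `α ↘ 1` -/

section OrderOne

variable {A : Type*} [Fintype A] [DecidableEq A]

/-- The tangent of `x ↦ x ^ α` at `y` lies below the graph. -/
lemma rpow_tangent_le {x y α : ℝ} (hx : 0 ≤ x) (hy : 0 ≤ y) (hα : 1 < α) :
    y ^ α + α * y ^ (α - 1) * (x - y) ≤ x ^ α := by
  rcases hy.eq_or_lt with rfl | hy
  · rw [Real.zero_rpow (by linarith), Real.zero_rpow (by linarith)]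
    simpa using Real.rpow_nonneg hx α
  · have h := one_add_mul_self_le_rpow_one_add (s := x / y - 1)
      (by have : 0 ≤ x / y := by positivity
          linarith) hα.le
    rw [add_sub_cancel, Real.div_rpow hx hy.le, le_div_iff₀ (Real.rpow_pos_of_pos hy α)] at h
    refine le_trans (le_of_eq ?_) h
    rw [Real.rpow_sub_one hy.ne']
    field_simp

/-- `M M†` and `M† M` have the same spectral sums. -/
lemma sum_eq_of_conjTranspose_mul_self {M E E' : Matrix A A ℂ} (hE : E ∈ unitaryGroup A ℂ)
    (hE' : E' ∈ unitaryGroup A ℂ) {g g' : A → ℝ} (h : Mᴴ * M = conjDiag E g)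
    (h' : M * Mᴴ = conjDiag E' g') (f : ℝ → ℝ) : ∑ i, f (g i) = ∑ i, f (g' i) := by
  have hcp : ∀ {V : Matrix A A ℂ}, V ∈ unitaryGroup A ℂ → ∀ d : A → ℝ,
      (conjDiag V d).charpoly.roots = Finset.univ.val.map fun i => (d i : ℂ) := by
    intro V hV d
    rw [conjDiag, Matrix.mul_assoc, charpoly_mul_comm, Matrix.mul_assoc,
      conjTranspose_mul_self_of_unitary hV, Matrix.mul_one, charpoly_diagonal]
    exact Polynomial.roots_multiset_prod_X_sub_C (Finset.univ.val.map fun i => (d i : ℂ)) ▸ by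
      rw [Multiset.map_map]; rfl
  have h1 : Finset.univ.val.map (fun i => (g i : ℂ)) = Finset.univ.val.map fun i => (g' i : ℂ) := by
    rw [← hcp hE g, ← hcp hE' g', ← h, ← h', charpoly_mul_comm]
  have h2 := congrArg (fun m => (m.map fun z : ℂ => f z.re).sum) h1
  simpa only [Multiset.map_map, Function.comp_def, Complex.ofReal_re, Finset.sum_map_val] using h2

/-- Quantitative comparison of the sandwiched quantity with its value at `α = 1`, for a state
`τ = E diag(p) E†` supported on the support of `σ = W diag(r) W†`: with
`b = Tr[τ σ^{(1-α)/α}]`, it is at most `Tr τ^α + α b^{α-1} (b - 1)`. -/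
lemma schattenNorm_rpow_le {E W : Matrix A A ℂ} (hE : E ∈ unitaryGroup A ℂ)
    (hW : W ∈ unitaryGroup A ℂ) {p r : A → ℝ} (hp : ∀ i, 0 ≤ p i) (hp1 : ∑ i, p i = 1)
    (hr : ∀ k, 0 ≤ r k) (hr1 : ∀ k, r k ≤ 1) (hsupp : supp (conjDiag E p) ≤ supp (conjDiag W r))
    {α b : ℝ} (hα : 1 < α)
    (hb : b = ∑ k, ∑ i, overlap W E k i * (r k ^ ((1 - α) / α) * p i)) :
    0 < schattenNorm α (suppPow (conjDiag W r) ((1 - α) / (2 * α)) * conjDiag E p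
      * suppPow (conjDiag W r) ((1 - α) / (2 * α))) ^ α ∧
    schattenNorm α (suppPow (conjDiag W r) ((1 - α) / (2 * α)) * conjDiag E p
      * suppPow (conjDiag W r) ((1 - α) / (2 * α))) ^ α
      ≤ ∑ i, p i ^ α + α * b ^ (α - 1) * (b - 1) := by
  have hα0 : 0 < α := by linarith
  have hα1 : 0 < α - 1 := by linarith
  set c := (1 - α) / (2 * α) with hc
  have hc0 : c < 0 := div_neg_of_neg_of_pos (by linarith) (by positivity)
  have hcc : c + c = (1 - α) / α := by rw [hc]; field_simp; ring
  set R := conjDiag W (fun k => r k ^ c) with hR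
  have hRh : Rᴴ = R := conjDiag_isHermitian _ _
  set S := conjDiag E (fun i => √(p i)) with hS
  have hSh : Sᴴ = S := conjDiag_isHermitian _ _
  have hSS : S * S = conjDiag E p := by
    rw [hS, conjDiag_mul hE]
    congr 1; funext i; exact Real.mul_self_sqrt (hp i)
  have hRR : R * R = conjDiag W (fun k => r k ^ ((1 - α) / α)) := by
    rw [hR, conjDiag_mul hW]
    congr 1; funext k
    rcases (hr k).eq_or_lt with h0 | h0
    · rw [← h0, Real.zero_rpow hc0.ne, Real.zero_rpow (by rw [← hcc]; linarith), zero_mul]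
    · rw [← Real.rpow_add h0, hcc]
  rw [suppPow_conjDiag hW]
  -- `G = R τ R = M† M` is traded for `G' = M M†`, which dominates `τ`
  have hG : R * conjDiag E p * R = (S * R)ᴴ * (S * R) := by
    rw [conjTranspose_mul, hRh, hSh, ← hSS]; simp only [Matrix.mul_assoc]
  have hG' : (S * R) * (S * R)ᴴ = S * (R * R) * S := by
    rw [conjTranspose_mul, hRh, hSh]; simp only [Matrix.mul_assoc]
  obtain ⟨E₁, hE₁, g₁, hg₁, hG₁⟩ :=
    exists_eq_conjDiag_of_posSemidef (posSemidef_conjTranspose_mul_self (S * R))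
  obtain ⟨E₂, hE₂, g, hg, hG₂⟩ :=
    exists_eq_conjDiag_of_posSemidef (posSemidef_self_mul_conjTranspose (S * R))
  rw [hG, hG₁, schattenNorm_conjDiag_rpow hE₁ _ hα0,
    sum_eq_of_conjTranspose_mul_self hE₁ hE₂ hG₁ hG₂ (fun x => |x| ^ α)]
  have habs : ∀ i, |g i| = g i := fun i => abs_of_nonneg (hg i)
  simp_rw [habs]
  set t : A → ℝ := fun i => ∑ j, overlap E₂ E i j * p j with ht
  have ht1 : ∑ i, t i = 1 := by rw [← hp1]; exact sum_overlap_mul_right hE₂ hE p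
  -- the diagonal of `G' - τ` in the eigenbasis of `G'` is nonnegative
  have htg : ∀ i, t i ≤ g i := by
    have hPτ : S * conjDiag W (fun k => if r k = 0 then 0 else 1) * S = conjDiag E p := by
      have hsuppS : supp S ≤ supp (conjDiag W r) := by
        refine supp_le_of_overlap hW fun k hk i => ?_
        rcases mul_eq_zero.1 (overlap_mul_eq_zero hW hE hsupp hk i) with h | h
        · rw [h, zero_mul]
        · rw [h, Real.sqrt_zero, mul_zero]
      rw [Matrix.mul_assoc, conjDiag_mul_congr hW hsuppS (f₂ := fun _ => 1)
        (fun k hk => by simp [hk]), conjDiag_const hW, one_smul, Matrix.one_mul, hSS]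
    have hpsd : (conjDiag E₂ g - conjDiag E p).PosSemidef := by
      rw [← hG₂, hG', hRR, ← hPτ, ← Matrix.sub_mul, ← Matrix.mul_sub]
      have e : conjDiag W (fun k => r k ^ ((1 - α) / α))
          - conjDiag W (fun k => if r k = 0 then 0 else 1)
          = conjDiag W (fun k => r k ^ ((1 - α) / α) - if r k = 0 then 0 else 1) := by
        rw [sub_eq_iff_eq_add, conjDiag_add]
        congr 1; funext k; ring
      rw [e]
      have := (conjDiag_posSemidef W (d := fun k => r k ^ ((1 - α) / α)
        - if r k = 0 then 0 else 1) fun k => by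
          by_cases h0 : r k = 0
          · simp only [h0, if_true, sub_zero]
            exact Real.rpow_nonneg le_rfl _
          · simp only [h0, if_false, sub_nonneg]
            exact Real.one_le_rpow_of_pos_of_le_one_of_nonpos (lt_of_le_of_ne (hr k) (Ne.symm h0))
              (hr1 k) (by rw [← hcc]; linarith)).mul_mul_conjTranspose_same S
      rwa [hSh] at this
    intro i
    have h1 := (hpsd.conjTranspose_mul_mul_same E₂).diag_nonneg (i := i)
    have h2 : (E₂ᴴ * (conjDiag E₂ g - conjDiag E p) * E₂) i i = ((g i - t i : ℝ) : ℂ) := by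
      rw [Matrix.mul_sub, Matrix.sub_mul, Matrix.sub_apply]
      have e1 : E₂ᴴ * conjDiag E₂ g * E₂ = diagonal fun i => (g i : ℂ) := by
        unfold conjDiag
        calc _ = (E₂ᴴ * E₂) * (diagonal fun i => (g i : ℂ)) * (E₂ᴴ * E₂) := by
              simp only [Matrix.mul_assoc]
          _ = _ := by
              rw [conjTranspose_mul_self_of_unitary hE₂, Matrix.one_mul, Matrix.mul_one]
      have e2 : E₂ᴴ * conjDiag E p * E₂ = (E₂ᴴ * E) * (diagonal fun i => (p i : ℂ))
          * (E₂ᴴ * E)ᴴ := by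
        rw [conjTranspose_mul, conjTranspose_conjTranspose, conjDiag]
        simp only [Matrix.mul_assoc]
      rw [e1, e2, diagonal_apply_eq, mul_apply]
      push_cast
      congr 1
      simp only [ht]
      push_cast
      refine Finset.sum_congr rfl fun j _ => ?_
      rw [mul_diagonal, conjTranspose_apply, overlap, Complex.star_def]
      push_cast
      rw [← Complex.mul_conj']
      ring
    rw [h2] at h1
    have : (0 : ℝ) ≤ g i - t i := by exact_mod_cast h1
    linarith
  have ht0 : ∀ i, 0 ≤ t i := fun i =>
    Finset.sum_nonneg fun j _ => mul_nonneg (overlap_nonneg _ _ _ _) (hp j)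
  have hgb : ∑ i, g i = b := by
    have h1 : ((∑ i, g i : ℝ) : ℂ) = (conjDiag W (fun k => r k ^ ((1 - α) / α))
        * conjDiag E p).trace := by
      rw [← trace_conjDiag hE₂, ← hG₂, hG', hRR, Matrix.mul_assoc, trace_mul_comm,
        Matrix.mul_assoc, hSS]
    rw [trace_conjDiag_mul] at h1
    rw [hb]
    exact_mod_cast h1
  have hgle : ∀ i, g i ≤ b := fun i => by
    rw [← hgb]; exact Finset.single_le_sum (fun j _ => hg j) (Finset.mem_univ i)
  refine ⟨?_, ?_⟩
  · obtain ⟨i, -, hi⟩ : ∃ i ∈ Finset.univ, 0 < t i := by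
      by_contra! hcon
      have := Finset.sum_nonpos hcon
      linarith
    exact Finset.sum_pos' (fun j _ => Real.rpow_nonneg (hg j) α)
      ⟨i, Finset.mem_univ i, Real.rpow_pos_of_pos (hi.trans_le (htg i)) α⟩
  · -- Klein's inequality for `x ↦ x ^ α`
    have hklein : ∑ i, ∑ j, overlap E₂ E i j * (g i ^ α + α * g i ^ (α - 1) * (p j - g i))
        ≤ ∑ i, ∑ j, overlap E₂ E i j * p j ^ α :=
      Finset.sum_le_sum fun i _ => Finset.sum_le_sum fun j _ =>
        mul_le_mul_of_nonneg_left (rpow_tangent_le (hp j) (hg i) hα) (overlap_nonneg _ _ _ _)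
    rw [sum_overlap_mul_right hE₂ hE fun j => p j ^ α] at hklein
    have e : ∀ i, ∑ j, overlap E₂ E i j * (g i ^ α + α * g i ^ (α - 1) * (p j - g i))
        = g i ^ α - α * (g i ^ (α - 1) * (g i - t i)) := by
      intro i
      have : ∀ j, overlap E₂ E i j * (g i ^ α + α * g i ^ (α - 1) * (p j - g i))
          = overlap E₂ E i j * (g i ^ α - α * g i ^ (α - 1) * g i)
            + α * g i ^ (α - 1) * (overlap E₂ E i j * p j) := fun j => by ring
      simp_rw [this, Finset.sum_add_distrib, ← Finset.sum_mul, ← Finset.mul_sum]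
      rw [sum_overlap_right hE₂ hE]
      simp only [ht]
      ring
    simp_rw [e, Finset.sum_sub_distrib, ← Finset.mul_sum] at hklein
    have hrest : ∑ i, g i ^ (α - 1) * (g i - t i) ≤ b ^ (α - 1) * (b - 1) := by
      calc ∑ i, g i ^ (α - 1) * (g i - t i) ≤ ∑ i, b ^ (α - 1) * (g i - t i) :=
            Finset.sum_le_sum fun i _ => mul_le_mul_of_nonneg_right
              (Real.rpow_le_rpow (hg i) (hgle i) hα1.le) (by linarith [htg i])
        _ = _ := by rw [← Finset.mul_sum, Finset.sum_sub_distrib, hgb, ht1]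
    have := mul_le_mul_of_nonneg_left hrest hα0.le
    nlinarith

/-- As `α ↘ 1`, the sandwiched divergence of a state is eventually below anything above the Umegaki
relative entropy. -/
lemma eventually_sandwiched_le {E W : Matrix A A ℂ} (hE : E ∈ unitaryGroup A ℂ)
    (hW : W ∈ unitaryGroup A ℂ) {p r : A → ℝ} (hp : ∀ i, 0 ≤ p i) (hp1 : ∑ i, p i = 1)
    (hr : ∀ k, 0 ≤ r k) (hr1 : ∀ k, r k ≤ 1) (hsupp : supp (conjDiag E p) ≤ supp (conjDiag W r))
    {D : ℝ} (hD : ∑ i, p i * Real.log (p i)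
      - ∑ k, ∑ i, overlap W E k i * (p i * Real.log (r k)) < D) :
    ∀ᶠ α in 𝓝[>] (1 : ℝ), 1 / (α - 1) * Real.log (schattenNorm α
      (suppPow (conjDiag W r) ((1 - α) / (2 * α)) * conjDiag E p
        * suppPow (conjDiag W r) ((1 - α) / (2 * α))) ^ α) ≤ D := by
  -- smooth versions of `Tr τ^α` and of `b`, with exponentials in place of powers of zero
  set u : ℝ → ℝ := fun α => ∑ i, p i * Real.exp ((α - 1) * Real.log (p i)) with hu
  set b : ℝ → ℝ := fun α => ∑ k, ∑ i, overlap W E k i *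
    (p i * Real.exp ((1 - α) / α * Real.log (r k))) with hb
  have hu1 : u 1 = 1 := by simp [hu, hp1]
  have hb1 : b 1 = 1 := by
    simp only [hb, sub_self, zero_div, zero_mul, Real.exp_zero, mul_one]
    rw [sum_overlap_mul_right hW hE, hp1]
  have hud : HasDerivAt u (∑ i, p i * Real.log (p i)) 1 := by
    refine HasDerivAt.fun_sum fun i _ => ?_
    have h1 : HasDerivAt (fun α : ℝ => (α - 1) * Real.log (p i)) (Real.log (p i)) 1 := by
      simpa using ((hasDerivAt_id (1 : ℝ)).sub_const 1).mul_const (Real.log (p i))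
    simpa using (h1.exp).const_mul (p i)
  have hbd : HasDerivAt b (-∑ k, ∑ i, overlap W E k i * (p i * Real.log (r k))) 1 := by
    rw [← Finset.sum_neg_distrib]
    refine HasDerivAt.fun_sum fun k _ => ?_
    rw [← Finset.sum_neg_distrib]
    refine HasDerivAt.fun_sum fun i _ => ?_
    have h0 : HasDerivAt (fun α : ℝ => (1 - α) / α) (-1) 1 := by
      simpa using ((hasDerivAt_id (1 : ℝ)).const_sub 1).fun_div (hasDerivAt_id (1 : ℝ)) one_ne_zero
    have h1 := h0.mul_const (Real.log (r k))
    have h2 := ((h1.exp).const_mul (p i)).const_mul (overlap W E k i)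
    refine h2.congr_deriv ?_
    simp
  have hus := (hasDerivAt_iff_tendsto_slope.1 hud).mono_left
    (nhdsWithin_mono 1 (fun t (ht : t ∈ Set.Ioi (1 : ℝ)) => (ne_of_gt ht : t ≠ 1)))
  have hbs := (hasDerivAt_iff_tendsto_slope.1 hbd).mono_left
    (nhdsWithin_mono 1 (fun t (ht : t ∈ Set.Ioi (1 : ℝ)) => (ne_of_gt ht : t ≠ 1)))
  have hbpow : Filter.Tendsto (fun α : ℝ => α * b α ^ (α - 1)) (𝓝[>] 1) (𝓝 1) := by
    have hc : ContinuousAt (fun α : ℝ => α * b α ^ (α - 1)) 1 := by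
      refine continuousAt_id.mul (hbd.continuousAt.rpow (continuousAt_id.sub continuousAt_const) ?_)
      left
      rw [hb1]; exact one_ne_zero
    have := hc.tendsto
    simp only [hb1, sub_self, Real.rpow_zero, mul_one] at this
    exact this.mono_left nhdsWithin_le_nhds
  have hlim := hus.add (hbpow.mul hbs)
  rw [one_mul, ← sub_eq_add_neg] at hlim
  filter_upwards [hlim.eventually (eventually_lt_nhds hD), self_mem_nhdsWithin] with α hlt hα
  have hα' : 1 < α := hα
  have hα1 : 0 < α - 1 := by linarith
  have hbα : b α = ∑ k, ∑ i, overlap W E k i * (r k ^ ((1 - α) / α) * p i) := by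
    refine Finset.sum_congr rfl fun k _ => Finset.sum_congr rfl fun i _ => ?_
    rcases (hr k).eq_or_lt with h0 | h0
    · rcases mul_eq_zero.1 (overlap_mul_eq_zero hW hE hsupp h0.symm i) with h | h
      · rw [h, zero_mul, zero_mul]
      · simp [h]
    · rw [Real.rpow_def_of_pos h0, mul_comm (Real.log (r k)), mul_comm (p i)]
  have huα : u α = ∑ i, p i ^ α := by
    refine Finset.sum_congr rfl fun i _ => ?_
    rcases (hp i).eq_or_lt with h0 | h0
    · rw [← h0, Real.zero_rpow (by linarith), zero_mul]
    · rw [Real.rpow_def_of_pos h0]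
      nth_rewrite 1 [← Real.exp_log h0]
      rw [← Real.exp_add]
      congr 1; ring
  obtain ⟨hpos, hle⟩ := schattenNorm_rpow_le hE hW hp hp1 hr hr1 hsupp hα' hbα
  rw [← huα] at hle
  have hlog := Real.log_le_sub_one_of_pos hpos
  simp only [slope_def_field, hu1, hb1] at hlt
  refine le_trans ?_ hlt.le
  rw [one_div, inv_mul_le_iff₀ hα1]
  have e : (α - 1) * ((u α - 1) / (α - 1) + α * b α ^ (α - 1) * ((b α - 1) / (α - 1)))
      = u α - 1 + α * b α ^ (α - 1) * (b α - 1) := by field_simp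
  rw [e]
  linarith

end OrderOne

/-! ### The upper bounds -/

section UpperBounds

variable {A : Type*} [Fintype A] [DecidableEq A] {r : ℕ}

/-- If the log-Euclidean divergences stay below `C`, then for every `D > C` there are an order
`α > 1` and a single state whose sandwiched divergences of order `α` are all at most `D`. -/
lemma exists_state_sandwiched_le (hr : 1 ≤ r) {ρ : Fin r → Matrix A A ℂ}
    (hρ : ∀ x, ρ x ∈ states A) {C D : ℝ} (hCD : C < D)
    (hC : ∀ s ∈ stdSimplex ℝ (Fin r), ∀ ε > 0, logEuclidean s ρ ε ≤ C) :
    ∃ α > 1, ∃ τ ∈ states A, ∀ x, sandwiched α τ (ρ x) ≤ (D : EReal) := by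
  have : Nonempty A := nonempty_of_states (hρ ⟨0, hr⟩)
  obtain ⟨τ, hτ, h⟩ := exists_state_forall_regularised_le hr (fun x => (hρ x).1) hC
  obtain ⟨E, hE, p, hp, rfl⟩ := exists_eq_conjDiag_of_posSemidef hτ.1
  have hp1 : ∑ i, p i = 1 := by
    have := hτ.2
    rw [trace_conjDiag hE] at this
    exact_mod_cast this
  choose W hW d hd hx using fun x => exists_eq_conjDiag_of_posSemidef (hρ x).1
  have hd1 : ∀ x k, d x k ≤ 1 := fun x k => by
    have := (hρ x).2
    rw [hx x, trace_conjDiag (hW x)] at this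
    have h1 : ∑ k, d x k = 1 := by exact_mod_cast this
    rw [← h1]
    exact Finset.single_le_sum (fun j _ => hd x j) (Finset.mem_univ k)
  have key : ∀ x, ∀ᶠ α in 𝓝[>] (1 : ℝ), sandwiched α (conjDiag E p) (ρ x) ≤ (D : EReal) := by
    intro x
    obtain ⟨hsupp, hle⟩ := supp_le_and_relEntropy_le hE (hW x) hp hp1 (hd x) (hd1 x)
      (fun n K hK => by rw [← hx x]; exact h n x K hK)
    filter_upwards [eventually_sandwiched_le hE (hW x) hp hp1 (hd x) (hd1 x) hsupp
      (hle.trans_lt hCD)] with α hα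
    rw [hx x, sandwiched, if_pos hsupp]
    exact EReal.coe_le_coe_iff.2 hα
  obtain ⟨α, hα, hα1⟩ := ((Filter.eventually_all.2 key).and self_mem_nhdsWithin).exists
  exact ⟨α, hα1, _, hτ, hα⟩

lemma sum_mul_le_of_forall_le {s : Fin r → ℝ} (hs : s ∈ stdSimplex ℝ (Fin r)) {f : Fin r → EReal}
    {D : ℝ} (hf : ∀ x, f x ≤ (D : EReal)) : ∑ x, (s x : EReal) * f x ≤ (D : EReal) := by
  calc ∑ x, (s x : EReal) * f x ≤ ∑ x, ((s x * D : ℝ) : EReal) :=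
        Finset.sum_le_sum fun x _ => by
          rw [EReal.coe_mul]
          exact mul_le_mul_of_nonneg_left (hf x) (EReal.coe_nonneg.2 (hs.1 x))
    _ = (D : EReal) := by rw [← ereal_coe_sum, ← Finset.sum_mul, hs.2, one_mul]

lemma tensorPow_mem_states {n : ℕ} {τ : Matrix A A ℂ} (hτ : τ ∈ states A) :
    tensorPow n τ ∈ states (Fin n → A) := by
  obtain ⟨V, -, p, hp, hV⟩ := exists_eq_conjDiag_of_posSemidef hτ.1
  refine ⟨?_, by rw [trace_tensorPow, hτ.2, one_pow]⟩
  rw [hV, tensorPow_conjDiag]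
  exact conjDiag_posSemidef _ fun i => Finset.prod_nonneg fun k _ => hp _

lemma suppPow_tensorPow {n : ℕ} {σ : Matrix A A ℂ} (hσ : σ.PosSemidef) (c : ℝ) :
    suppPow (tensorPow n σ) c = tensorPow n (suppPow σ c) := by
  obtain ⟨V, hV, d, hd, rfl⟩ := exists_eq_conjDiag_of_posSemidef hσ
  rw [tensorPow_conjDiag, suppPow_conjDiag (tensorPow_mem_unitaryGroup hV), suppPow_conjDiag hV,
    tensorPow_conjDiag]
  congr 1
  funext i
  exact (Real.finsetProd_rpow _ _ (fun k _ => hd _) c).symm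

lemma schattenNorm_tensorPow_rpow {n : ℕ} {γ : Matrix A A ℂ} (hγ : γ.IsHermitian) {α : ℝ}
    (hα : 0 < α) : schattenNorm α (tensorPow n γ) ^ α = (schattenNorm α γ ^ α) ^ n := by
  obtain ⟨V, hV, g, rfl⟩ := exists_eq_conjDiag hγ
  rw [tensorPow_conjDiag, schattenNorm_conjDiag_rpow (tensorPow_mem_unitaryGroup hV) _ hα,
    schattenNorm_conjDiag_rpow hV _ hα, Fintype.sum_pow]
  refine Finset.sum_congr rfl fun i _ => ?_
  rw [Finset.abs_prod, Real.finsetProd_rpow _ _ fun k _ => abs_nonneg _]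

/-- The sandwiched divergence of tensor powers is at most `n` times the single-copy one. -/
lemma sandwiched_tensorPow_le {n : ℕ} {γ σ : Matrix A A ℂ} (hγ : γ.IsHermitian)
    (hσ : σ.PosSemidef) {α : ℝ} (hα : 1 < α) {D : ℝ} (h : sandwiched α γ σ ≤ (D : EReal)) :
    sandwiched α (tensorPow n γ) (tensorPow n σ) ≤ ((n * D : ℝ) : EReal) := by
  by_cases hsupp : supp γ ≤ supp σ
  · have hsupp' : supp (tensorPow n γ) ≤ supp (tensorPow n σ) := by
      obtain ⟨X, rfl⟩ := (supp_le_iff _ _).1 hsupp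
      exact (supp_le_iff _ _).2 ⟨tensorPow n X, (tensorPow_mul σ X).symm⟩
    rw [sandwiched, if_pos hsupp, EReal.coe_le_coe_iff] at h
    have hG : (suppPow σ ((1 - α) / (2 * α)) * γ * suppPow σ ((1 - α) / (2 * α))).IsHermitian := by
      have hS : (suppPow σ ((1 - α) / (2 * α))).IsHermitian := cfc_isHermitian _ _
      have := isHermitian_mul_mul_conjTranspose (suppPow σ ((1 - α) / (2 * α))) hγ
      rwa [hS.eq] at this
    rw [sandwiched, if_pos hsupp', EReal.coe_le_coe_iff, suppPow_tensorPow hσ, tensorPow_mul,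
      tensorPow_mul, schattenNorm_tensorPow_rpow hG (by linarith), Real.log_pow]
    calc _ = (n : ℝ) * (1 / (α - 1) * Real.log (schattenNorm α
          (suppPow σ ((1 - α) / (2 * α)) * γ * suppPow σ ((1 - α) / (2 * α))) ^ α)) := by ring
      _ ≤ _ := mul_le_mul_of_nonneg_left h (Nat.cast_nonneg n)
  · rw [sandwiched, if_neg hsupp] at h
    exact absurd h (by simp)

/-- To bound by `C♭` from above a quantity, it suffices to bound it by every `D` for which some
state has all its sandwiched divergences of some order `α > 1` below `D`. -/
lemma le_chernoffFlat_of_forall (hr : 1 ≤ r) {ρ : Fin r → Matrix A A ℂ}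
    (hρ : ∀ x, ρ x ∈ states A) {a : EReal}
    (h : ∀ D : ℝ, ∀ α > 1, ∀ τ ∈ states A, (∀ x, sandwiched α τ (ρ x) ≤ (D : EReal)) →
      a ≤ (D : EReal)) : a ≤ chernoffFlat ρ := by
  have : Nonempty A := nonempty_of_states (hρ ⟨0, hr⟩)
  refine le_of_forall_gt_imp_ge_of_dense fun b hb => ?_
  obtain ⟨D, hD, hDb⟩ := EReal.lt_iff_exists_real_btwn.1 hb
  obtain ⟨C, hC, hCD⟩ := EReal.lt_iff_exists_real_btwn.1 hD
  rw [chernoffFlat_eq fun x => (hρ x).1] at hC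
  obtain ⟨α, hα, τ, hτ, hle⟩ := exists_state_sandwiched_le hr hρ (EReal.coe_lt_coe_iff.1 hCD)
    (fun s hs ε hε => EReal.coe_le_coe_iff.1 (le_trans
      (le_trans (le_biSup (fun ε : ℝ => ((logEuclidean s ρ ε : ℝ) : EReal)) hε)
        (le_biSup (fun s => ⨆ ε ∈ Set.Ioi (0 : ℝ), ((logEuclidean s ρ ε : ℝ) : EReal)) hs)) hC.le))
  exact (h D α hα τ hτ hle).trans hDb.le

lemma states_subset_affStates (B : Type*) [Fintype B] : states B ⊆ affStates B :=
  fun _ h => ⟨h.1.1, h.2⟩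

lemma regularised_le_chernoffFlat (hr : 1 ≤ r) {ρ : Fin r → Matrix A A ℂ}
    (hρ : ∀ x, ρ x ∈ states A) :
    (⨅ α ∈ Set.Ioi (1 : ℝ), Filter.limsup (fun n : ℕ =>
      ⨆ s ∈ stdSimplex ℝ (Fin r), ⨅ τ ∈ states (Fin n → A),
        ((1 / (n : ℝ) : ℝ) : EReal) * ∑ x, ((s x : ℝ) : EReal) *
          sandwiched α τ (tensorPow n (ρ x))) Filter.atTop) ≤ chernoffFlat ρ := by
  refine le_chernoffFlat_of_forall hr hρ fun D α hα τ hτ hle => ?_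
  refine iInf₂_le_of_le α hα (Filter.limsup_le_of_le (h := ?_))
  filter_upwards [Filter.eventually_gt_atTop 0] with n hn
  refine iSup₂_le fun s hs => iInf₂_le_of_le (tensorPow n τ) (tensorPow_mem_states hτ) ?_
  have hn' : (0 : ℝ) < n := by exact_mod_cast hn
  have h1 := sum_mul_le_of_forall_le hs
    fun x => sandwiched_tensorPow_le (n := n) hτ.1.1 (hρ x).1 hα (hle x)
  refine (mul_le_mul_of_nonneg_left h1
    (EReal.coe_nonneg.2 (by positivity : (0 : ℝ) ≤ 1 / (n : ℝ)))).trans (le_of_eq ?_)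
  rw [← EReal.coe_mul]
  congr 1
  field_simp

lemma oneShot_le_chernoffFlat (hr : 1 ≤ r) {ρ : Fin r → Matrix A A ℂ}
    (hρ : ∀ x, ρ x ∈ states A) :
    (⨅ α ∈ Set.Ioi (1 : ℝ), ⨆ s ∈ stdSimplex ℝ (Fin r), ⨅ τ ∈ states A,
      ∑ x, ((s x : ℝ) : EReal) * sandwiched α τ (ρ x)) ≤ chernoffFlat ρ :=
  le_chernoffFlat_of_forall hr hρ fun _ α hα τ hτ hle =>
    iInf₂_le_of_le α hα (iSup₂_le fun _ hs => iInf₂_le_of_le τ hτ (sum_mul_le_of_forall_le hs hle))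

end UpperBounds

end StateExclusion

theorem proposition3 {A : Type*} [Fintype A] [DecidableEq A] {r : ℕ} (hr : 1 ≤ r)
    (ρ : Fin r → Matrix A A ℂ) (hρ : ∀ x, ρ x ∈ StateExclusion.states A) :
    -- the limit in the definition of `C♭` exists in `[-∞, +∞]`
    (∀ s ∈ stdSimplex ℝ (Fin r), ∃ l : EReal,
      Filter.Tendsto (fun ε : ℝ => ((StateExclusion.logEuclidean s ρ ε : ℝ) : EReal))
        (𝓝[>] (0 : ℝ)) (𝓝 l)) ∧
    -- the extended regularized bound equals `C♭`
    (⨅ α ∈ Set.Ioi (1 : ℝ), Filter.limsup (fun n : ℕ =>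
        ⨆ s ∈ stdSimplex ℝ (Fin r), ⨅ τ ∈ StateExclusion.affStates (Fin n → A),
          ((1 / (n : ℝ) : ℝ) : EReal) * ∑ x, ((s x : ℝ) : EReal) *
            StateExclusion.sandwiched α τ (StateExclusion.tensorPow n (ρ x)))
        Filter.atTop) = StateExclusion.chernoffFlat ρ ∧
    -- so does the regularized bound with states only
    (⨅ α ∈ Set.Ioi (1 : ℝ), Filter.limsup (fun n : ℕ =>
        ⨆ s ∈ stdSimplex ℝ (Fin r), ⨅ τ ∈ StateExclusion.states (Fin n → A),
          ((1 / (n : ℝ) : ℝ) : EReal) * ∑ x, ((s x : ℝ) : EReal) *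
            StateExclusion.sandwiched α τ (StateExclusion.tensorPow n (ρ x)))
        Filter.atTop) = StateExclusion.chernoffFlat ρ ∧
    -- so does the extended bound without regularization
    (⨅ α ∈ Set.Ioi (1 : ℝ), ⨆ s ∈ stdSimplex ℝ (Fin r), ⨅ τ ∈ StateExclusion.affStates A,
        ∑ x, ((s x : ℝ) : EReal) * StateExclusion.sandwiched α τ (ρ x)) =
      StateExclusion.chernoffFlat ρ ∧
    -- and the bound with states only and without regularization
    (⨅ α ∈ Set.Ioi (1 : ℝ), ⨆ s ∈ stdSimplex ℝ (Fin r), ⨅ τ ∈ StateExclusion.states A,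
        ∑ x, ((s x : ℝ) : EReal) * StateExclusion.sandwiched α τ (ρ x)) =
      StateExclusion.chernoffFlat ρ := by
  have : Nonempty A := StateExclusion.nonempty_of_states (hρ ⟨0, hr⟩)
  have hsub : ∀ (B : Type _) [Fintype B],
      StateExclusion.states B ⊆ StateExclusion.affStates B :=
    StateExclusion.states_subset_affStates
  have hupReg := StateExclusion.regularised_le_chernoffFlat hr hρ
  have hup := StateExclusion.oneShot_le_chernoffFlat hr hρ
  have hlimsup : ∀ {u : ℕ → EReal}, (∀ n, 0 < n → StateExclusion.chernoffFlat ρ ≤ u n) →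
      StateExclusion.chernoffFlat ρ ≤ Filter.limsup u Filter.atTop := fun h =>
    Filter.le_limsup_of_frequently_le
      ((Filter.eventually_gt_atTop 0).mono fun n hn => h n hn).frequently
  refine ⟨fun s hs => ⟨_, StateExclusion.tendsto_logEuclidean hs.1 fun x => (hρ x).1⟩,
    le_antisymm ?_ ?_, le_antisymm hupReg ?_, le_antisymm ?_ ?_, le_antisymm hup ?_⟩
  · exact (iInf₂_mono fun α _ => Filter.limsup_le_limsup (Filter.Eventually.of_forall fun n =>
      iSup₂_mono fun s _ => biInf_mono (hsub _))).trans hupReg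
  · exact le_iInf₂ fun α hα => hlimsup fun n hn =>
      StateExclusion.chernoffFlat_le_regularised (fun x => (hρ x).1) hα hn
  · exact le_iInf₂ fun α hα => hlimsup fun n hn =>
      (StateExclusion.chernoffFlat_le_regularised (fun x => (hρ x).1) hα hn).trans
        (iSup₂_mono fun s _ => biInf_mono (hsub _))
  · exact (iInf₂_mono fun α _ => iSup₂_mono fun s _ => biInf_mono (hsub _)).trans hup
  · exact le_iInf₂ fun α hα => StateExclusion.chernoffFlat_le_oneShot (fun x => (hρ x).1) hα
  · exact le_iInf₂ fun α hα => (StateExclusion.chernoffFlat_le_oneShot (fun x => (hρ x).1) hα).trans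
      (iSup₂_mono fun s _ => biInf_mono (hsub _))
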